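/- Let $d\ge 1$ and $B\in\mathbb N$. Let $\Omega$ be the space of environments $\omega=(\omega_x)_{x\in\mathbb Z^d}$, where each $\omega_x=(\pi(x,x+z))_{z\in\mathbb Z^d}$ is a probability vector on $\mathbb Z^d$, with the Borel $\sigma$-algebra of the product topology and the shifts $(T_z\omega)_x=\omega_{x+z}$. Let $\mathcal R=\{z\in\mathbb Z^d: 0<|z_1|+\dots+|z_d|\le B\}$ and $U=\{z\in\mathcal R: |z_1|+\dots+|z_d|=1\}$. Let $\mathbb P$ be a probability measure on $\Omega$ that is stationary and ergodic under $(T_z)_{z\in\mathbb Z^d}$ and satisfies, for each $z\notin\mathcal R$, $\pi(0,z)=0$ $\mathbb P$-a.s. For a probability measure $\mu$ on $\Omega\times\mathcal R$ let $(\mu)^1$ and $(\mu)^2$ be the laws under $\mu$ of $\omega$ and of $T_z\omega$, let $\xi_\mu=\int \sum_{z\in\mathcal R} d\mu(\omega,z)\,z\in\mathbb R^d$, and let $A_\xi=\{\mu:\xi_\mu=\xi\}$ for $\xi\in\mathbb R^d$. Let $M_{1,s}^{\ll}$ be the set of those $\mu$ with $(\mu)^1=(\mu)^2\ll\mathbb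 P$ and, for each $z\in U$, $\frac{d\mu(\omega,z)}{d(\mu)^1(\omega)}>0$ $\mathbb P$-a.s. Define $$\mathfrak I_q(\mu)=\int_\Omega\sum_{z\in\mathcal R}d\mu(\omega,z)\log\frac{d\mu(\omega,z)}{d(\mu)^1(\omega)\,\pi(0,z)}\in[0,\infty]\quad\text{if }\mu\in M_{1,s}^{\ll},\qquad \mathfrak I_q(\mu)=\infty\quad\text{otherwise},$$ and consider the variational formula $$I_q(\xi)=\inf_{\mu\in A_\xi}\mathfrak I_q(\mu).\qquad(*)$$ A measurable function $F:\Omega\times\mathcal R\to\mathbb R$ is in class $\mathcal K$ if: for each $z\in\mathcal R$, $F(\cdot,z)\in\bigcup_{\alpha>0}L^{d+\alpha}(\mathbb P)$; for each $z\in\mathcal R$, $\mathbb E[F(\cdot,z)]=0$; and for $\mathbb P$-a.e. $\omega$ and any finite sequence $(x_k)_{k=0}^n$ in $\mathbb Z^d$ with $x_0=x_n$ and all $x_{k+1}-x_k\in\mathcal R$, $\sum_{k=0}^{n-1}F(T_{x_k}\omega,x_{k+1}-x_k)=0$. **Lemma.** Let $\xi\in\mathbb R^d$. If $\mu_\xi\in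 A_\xi\cap M_{1,s}^{\ll}$ satisfies $$d\mu_\xi(\omega,z)=d(\mu_\xi)^1(\omega)\,\pi(0,z)\,e^{\langle\theta,z\rangle+F(\omega,z)+r}$$ for some $\theta\in\mathbb R^d$, $F\in\mathcal K$ and $r\in\mathbb R$, then $\mu_\xi$ is the unique minimizer of $(*)$: the infimum over $A_\xi$ is attained at $\mu_\xi$ and at no other element of $A_\xi$. -/

import Mathlib

open MeasureTheory
open scoped ENNReal

namespace RWRE

noncomputable section

/-- Probability vectors on `ℤ^d`: the possible values of `ω_x = (π(x, x + z))_z`. -/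
def StepLaw (d : ℕ) : Type :=
  {p : (Fin d → ℤ) → ℝ // (∀ z, 0 ≤ p z) ∧ HasSum p 1}

/-- The coordinatewise (product) topology on probability vectors. -/
instance (d : ℕ) : TopologicalSpace (StepLaw d) :=
  inferInstanceAs (TopologicalSpace
    {p : (Fin d → ℤ) → ℝ // (∀ z, 0 ≤ p z) ∧ HasSum p 1})

/-- The space `Ω` of environments `ω = (ω_x)_{x ∈ ℤ^d}`. -/
def Env (d : ℕ) : Type := (Fin d → ℤ) → StepLaw d

/-- The product topology on `Ω`. -/
instance (d : ℕ) : TopologicalSpace (Env d) :=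
  inferInstanceAs (TopologicalSpace ((Fin d → ℤ) → StepLaw d))

/-- The Borel σ-algebra of the product topology on `Ω`. -/
instance (d : ℕ) : MeasurableSpace (Env d) := borel (Env d)

instance (d : ℕ) : BorelSpace (Env d) := ⟨rfl⟩

/-- The shifts `T_z`, written `z +ᵥ ω`: `(T_z ω)_x = ω_{x + z}`. -/
instance (d : ℕ) : AddAction (Fin d → ℤ) (Env d) where
  vadd z ω := fun x => ω (x + z)
  zero_vadd ω := funext fun x => congrArg ω (add_zero x)
  add_vadd z w ω := funext fun x => congrArg ω (add_assoc x z w).symm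

/-- The transition probability `π(x, x + z)` in the environment `ω`. -/
def stepProb {d : ℕ} (ω : Env d) (x z : Fin d → ℤ) : ℝ := (ω x).1 z

/-- The set `ℛ` of allowed steps: `0 < |z_1| + ⋯ + |z_d| ≤ B`. -/
def steps (d B : ℕ) : Set (Fin d → ℤ) :=
  {z | 0 < ∑ i, |z i| ∧ ∑ i, |z i| ≤ (B : ℤ)}

/-- An allowed step belongs to `U` if `|z_1| + ⋯ + |z_d| = 1`. -/
def IsUnitStep {d B : ℕ} (z : steps d B) : Prop := ∑ i, |z.1 i| = 1

/-- A step seen as a vector of `ℝ^d`. -/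
def stepVec {d B : ℕ} (z : steps d B) : EuclideanSpace ℝ (Fin d) :=
  WithLp.toLp 2 fun i => (z.1 i : ℝ)

theorem continuous_shift {d : ℕ} (z : Fin d → ℤ) :
    Continuous fun ω : Env d => z +ᵥ ω :=
  continuous_pi fun x => continuous_apply (x + z)

/-- The map `(ω, z) ↦ T_z ω` is measurable, so that images of measures under it make sense. -/
theorem measurable_shift_step {d B : ℕ} :
    Measurable fun p : Env d × steps d B => (p.2 : Fin d → ℤ) +ᵥ p.1 :=
  measurable_from_prod_countable_left fun z => (continuous_shift z.1).measurable

/-- The marginal `(μ)¹`, of `ω` under `μ`. -/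
def marginal₁ {d B : ℕ} (μ : ProbabilityMeasure (Env d × steps d B)) : Measure (Env d) :=
  (μ : Measure (Env d × steps d B)).map Prod.fst

/-- The marginal `(μ)²`, of `T_z ω` under `μ`. -/
def marginal₂ {d B : ℕ} (μ : ProbabilityMeasure (Env d × steps d B)) : Measure (Env d) :=
  (μ : Measure (Env d × steps d B)).map fun p => (p.2 : Fin d → ℤ) +ᵥ p.1

/-- For a measure `Q` on `Ω` and `g : Ω × ℛ → ℝ`, `g ≥ 0`, the measure `dQ(ω) g(ω, z)` on
`Ω × ℛ`. -/
def semiProd {d B : ℕ} (Q : Measure (Env d)) (g : Env d × steps d B → ℝ) :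
    Measure (Env d × steps d B) :=
  (Q.prod Measure.count).withDensity fun p => ENNReal.ofReal (g p)

/-- The environment kernel `dμ(ω, z) / d(μ)¹(ω)`: the density of `μ` with respect to the
product of `(μ)¹` and the counting measure on `ℛ`. -/
def envKernel {d B : ℕ} (μ : ProbabilityMeasure (Env d × steps d B)) :
    Env d × steps d B → ℝ≥0∞ :=
  (μ : Measure (Env d × steps d B)).rnDeriv ((marginal₁ μ).prod Measure.count)

/-- The set `M_{1,s}^{≪}(Ω × ℛ)`. -/
def stationaryMeasures {d : ℕ} (B : ℕ) (P : Measure (Env d)) :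
    Set (ProbabilityMeasure (Env d × steps d B)) :=
  {μ | marginal₁ μ = marginal₂ μ ∧ marginal₁ μ ≪ P ∧
    ∀ z : steps d B, IsUnitStep z → ∀ᵐ ω ∂P, 0 < envKernel μ (ω, z)}

open Classical in
/-- The function `𝔍_q` on `M_1(Ω × ℛ)`: on `M_{1,s}^{≪}(Ω × ℛ)` it is the relative entropy
`∫ dμ(ω, z) log (dμ(ω, z) / (d(μ)¹(ω) π(0, z)))`, elsewhere it is `∞`. -/
def pairRate {d B : ℕ} (P : Measure (Env d)) (μ : ProbabilityMeasure (Env d × steps d B)) :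
    ℝ≥0∞ :=
  if μ ∈ stationaryMeasures B P then
    InformationTheory.klDiv (μ : Measure (Env d × steps d B))
      (semiProd (marginal₁ μ) fun p => stepProb p.1 0 p.2)
  else ∞

/-- The mean velocity `ξ_μ = ∫ ∑_z dμ(ω, z) z`. -/
def meanVelocity {d B : ℕ} (μ : ProbabilityMeasure (Env d × steps d B)) :
    EuclideanSpace ℝ (Fin d) :=
  ∫ p, stepVec p.2 ∂(μ : Measure (Env d × steps d B))

/-- The set `A_ξ` of probability measures on `Ω × ℛ` with mean velocity `ξ`. -/
def velocitySet {d : ℕ} (B : ℕ) (ξ : EuclideanSpace ℝ (Fin d)) :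
    Set (ProbabilityMeasure (Env d × steps d B)) :=
  {μ | meanVelocity μ = ξ}

/-- The variational formula for `I_q(ξ)`: the infimum of `𝔍_q` over `A_ξ`. -/
def velocityRate {d : ℕ} (B : ℕ) (P : Measure (Env d)) (ξ : EuclideanSpace ℝ (Fin d)) : ℝ≥0∞ :=
  ⨅ μ ∈ velocitySet B ξ, pairRate P μ

/-- The class `𝒦`. -/
structure ClassK {d B : ℕ} (P : Measure (Env d)) (F : Env d × steps d B → ℝ) : Prop where
  measurable : Measurable F
  moment : ∀ z : steps d B, ∃ α : ℝ, 0 < α ∧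
    MemLp (fun ω => F (ω, z)) (ENNReal.ofReal ((d : ℝ) + α)) P
  mean_zero : ∀ z : steps d B, ∫ ω, F (ω, z) ∂P = 0
  closed_loop : ∀ᵐ ω ∂P, ∀ (n : ℕ) (x : ℕ → Fin d → ℤ) (s : ℕ → steps d B),
    (∀ k < n, x (k + 1) - x k = s k) → x 0 = x n →
      ∑ k ∈ Finset.range n, F (x k +ᵥ ω, s k) = 0

end

end RWRE

/-! Let f = ⟨θ, z⟩ + F + r and, for ν in `stationaryMeasures B P`, let R_ν be the measure d(ν)¹(ω)
π(0, z), so that the rate of ν is the relative entropy H(ν | R_ν). The prescribed form of μ_ξ says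
that π(0, z) e^f is its environment kernel. The kernel sums to one (μ_ξ)¹-a.s., hence P-a.s. because
P ≪ (μ_ξ)¹, and hence (ν)¹-a.s. Thus e^f R_ν is a probability measure, and for ν in A_ξ of finite
rate H(ν | R_ν) = H(ν | e^f R_ν) + ∫ f dν, with ∫ f dν = ⟨θ, ξ⟩ + r. The rate is therefore at least
⟨θ, ξ⟩ + r, with equality exactly when ν = e^f R_ν. Two facts remain.

First, ∫ F dν = 0 (`ClassK.integrable_and_integral_eq_zero`), although ν is only controlled through
(ν)¹ ≪ P. The closed loop condition makes F the gradient of a potential V, a mean-zero cocycle. The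
L^p mean ergodic theorem makes V sublinear in L^q along rays; dyadic chaining with q > d upgrades
this to P-a.s. sublinearity on boxes along a subsequence of scales (`exists_seq_cocycle_sublinear`).
Minima of V over growing boxes, truncated from below, then bound the mean of F from below under any
stationary ν, and the same argument applies to -F.

Second, a stationary measure is determined by its kernel (`eq_of_eq_semiProd`). If two measures
share the kernel, the set where the density of one first marginal with respect to the other exceeds
1 is preserved by the steps; positivity on U and ergodicity make it trivial, so the density is 1.
The same mechanism, applied to the set where d(μ)¹/dP is positive, yields P ≪ (μ)¹. -/

section

open Filter Topology Finset

/-! ### The mean ergodic theorem in L^p -/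

theorem LinearIsometry.cauchySeq_birkhoffAverage {E : Type*} [NormedAddCommGroup E]
    [InnerProductSpace ℝ E] [CompleteSpace E] (U : E →ₗᵢ[ℝ] E) (x : E) :
    CauchySeq fun n => birkhoffAverage ℝ U _root_.id n x :=
  (ContinuousLinearMap.tendsto_birkhoffAverage_orthogonalProjection U.toContinuousLinearMap
    U.norm_toContinuousLinearMap_le x).cauchySeq

namespace MeasureTheory

variable {Ω : Type*} {mΩ : MeasurableSpace Ω} {μ : Measure Ω} {p : ℝ≥0∞}

theorem coeFn_birkhoffAverage_compMeasurePreserving [Fact (1 ≤ p)] {T : Ω → Ω}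
    (hT : MeasurePreserving T μ μ) (f : Lp ℝ p μ) (n : ℕ) :
    ((birkhoffAverage ℝ (Lp.compMeasurePreservingₗᵢ ℝ T hT) _root_.id n f : Lp ℝ p μ) : Ω → ℝ) =ᵐ[μ]
      birkhoffAverage ℝ T (f : Ω → ℝ) n := by
  have hsum : ∀ n, ((birkhoffSum (Lp.compMeasurePreservingₗᵢ ℝ T hT) _root_.id n f :
      Lp ℝ p μ) : Ω → ℝ) =ᵐ[μ]
      birkhoffSum T (f : Ω → ℝ) n := by
    intro n
    induction n with
    | zero => simpa using Lp.coeFn_zero ℝ p μ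
    | succ n ih =>
      rw [birkhoffSum_succ]
      have h1 : (((Lp.compMeasurePreservingₗᵢ ℝ T hT)^[n] f : Lp ℝ p μ) : Ω → ℝ) =ᵐ[μ]
          f ∘ T^[n] := by
        change (((Lp.compMeasurePreserving T hT)^[n] f : Lp ℝ p μ) : Ω → ℝ) =ᵐ[μ] f ∘ T^[n]
        rw [Lp.compMeasurePreserving_iterate hT n]
        exact Lp.coeFn_compMeasurePreserving _ _
      filter_upwards [ih, h1, Lp.coeFn_add (birkhoffSum (Lp.compMeasurePreservingₗᵢ ℝ T hT)
        _root_.id n f) (_root_.id ((Lp.compMeasurePreservingₗᵢ ℝ T hT)^[n] f))] with ω h2 h3 h4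
      rw [h4, Pi.add_apply, h2, _root_.id, h3, birkhoffSum_succ]
      rfl
  filter_upwards [hsum n, Lp.coeFn_smul (n : ℝ)⁻¹
    (birkhoffSum (Lp.compMeasurePreservingₗᵢ ℝ T hT) _root_.id n f)] with ω h1 h2
  rw [birkhoffAverage, h2, Pi.smul_apply, h1]
  rfl

/-- For uniformly bounded functions on a probability space, convergence to zero in `L²` implies
convergence to zero in `L^p` for all finite `p`. -/
theorem tendsto_eLpNorm_zero_of_bounded [IsProbabilityMeasure μ] (hp : p ≠ ∞) {ι : Type*}
    {l : Filter ι} {u : ι → Ω → ℝ} {K : ℝ} (hu : ∀ i, AEStronglyMeasurable (u i) μ)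
    (hK : ∀ i, ∀ᵐ ω ∂μ, |u i ω| ≤ K) (h2 : Tendsto (fun i => eLpNorm (u i) 2 μ) l (𝓝 0)) :
    Tendsto (fun i => eLpNorm (u i) p μ) l (𝓝 0) := by
  -- Raising the exponent to r ≥ 2 allows the pointwise interpolation |u|^r ≤ K^(r - 2) |u|².
  set r : ℝ := max p.toReal 2 with hr
  have hr2 : 2 ≤ r := le_max_right _ _
  have hr0 : 0 < r := by linarith
  have hpr : p ≤ ENNReal.ofReal r := by
    rw [← ENNReal.ofReal_toReal hp]
    exact ENNReal.ofReal_le_ofReal (le_max_left _ _)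
  set C : ℝ≥0∞ := ENNReal.ofReal K ^ (r - 2) with hC
  have hCtop : C ≠ ∞ := ENNReal.rpow_ne_top_of_nonneg (by linarith) ENNReal.ofReal_ne_top
  have key : ∀ i, eLpNorm (u i) p μ ≤ (C * eLpNorm (u i) 2 μ ^ (2 : ℝ)) ^ (1 / r) := by
    intro i
    refine (eLpNorm_le_eLpNorm_of_exponent_le hpr (hu i)).trans ?_
    rw [eLpNorm_eq_lintegral_rpow_enorm_toReal (by simpa using hr0) ENNReal.ofReal_ne_top,
      ENNReal.toReal_ofReal hr0.le]
    refine ENNReal.rpow_le_rpow ?_ (by positivity)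
    rw [eLpNorm_eq_lintegral_rpow_enorm_toReal (by norm_num) (by norm_num), ← ENNReal.rpow_mul]
    norm_num
    rw [← lintegral_const_mul' _ _ hCtop]
    refine lintegral_mono_ae ?_
    filter_upwards [hK i] with ω hω
    have h1 : ‖u i ω‖ₑ ≤ ENNReal.ofReal K := by
      rw [Real.enorm_eq_ofReal_abs]
      exact ENNReal.ofReal_le_ofReal hω
    calc ‖u i ω‖ₑ ^ r = ‖u i ω‖ₑ ^ (r - 2) * ‖u i ω‖ₑ ^ (2 : ℝ) := by
          rw [← ENNReal.rpow_add_of_nonneg _ _ (by linarith) (by norm_num)]; congr 1; ring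
      _ ≤ C * ‖u i ω‖ₑ ^ (2 : ℝ) := by
          gcongr
          exact ENNReal.rpow_le_rpow h1 (by linarith)
      _ = C * ‖u i ω‖ₑ ^ 2 := by norm_num
  refine tendsto_of_tendsto_of_tendsto_of_le_of_le tendsto_const_nhds ?_ (fun _ => zero_le) key
  have h3 := ((ENNReal.continuous_rpow_const (y := 2)).tendsto 0).comp h2
  have h4 := ENNReal.Tendsto.const_mul h3 (Or.inr hCtop)
  have h5 := ((ENNReal.continuous_rpow_const (y := 1 / r)).tendsto _).comp h4
  simpa [Function.comp_def, ENNReal.zero_rpow_of_pos (show (0 : ℝ) < r⁻¹ by positivity)] using h5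

theorem cauchySeq_birkhoffAverage_compMeasurePreserving_two {T : Ω → Ω}
    (hT : MeasurePreserving T μ μ) (f : Lp ℝ 2 μ) :
    CauchySeq fun n =>
      birkhoffAverage ℝ (Lp.compMeasurePreservingₗᵢ ℝ T hT) _root_.id n f :=
  LinearIsometry.cauchySeq_birkhoffAverage (E := Lp ℝ 2 μ)
    (Lp.compMeasurePreservingₗᵢ ℝ T hT) f

/-- The **mean ergodic theorem** in `L^p`, `1 ≤ p < ∞`, on a probability space. -/
theorem cauchySeq_birkhoffAverage_compMeasurePreserving [IsProbabilityMeasure μ]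
    [hp1 : Fact (1 ≤ p)] (hp : p ≠ ∞) {T : Ω → Ω} (hT : MeasurePreserving T μ μ) (f : Lp ℝ p μ) :
    CauchySeq fun n =>
      birkhoffAverage ℝ (Lp.compMeasurePreservingₗᵢ ℝ T hT) _root_.id n f := by
  induction f using Lp.induction hp with
  -- Averages of an indicator are bounded by |c|, so the Hilbert space theorem in L² already gives
  -- the Cauchy property in L^p.
  | @indicatorConst c s hs hμs =>
    have e : ∀ q : ℝ≥0∞, ∀ [Fact (1 ≤ q)], ((Lp.simpleFunc.indicatorConst q hs hμs.ne c :
        Lp ℝ q μ) : Ω → ℝ) =ᵐ[μ] s.indicator fun _ => c := by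
      intro q _
      rw [Lp.simpleFunc.coe_indicatorConst]
      exact indicatorConstLp_coeFn
    have bd : ∀ n ω, |birkhoffAverage ℝ T (s.indicator fun _ => c) n ω| ≤ |c| := by
      intro n ω
      rw [birkhoffAverage, smul_eq_mul, abs_mul, birkhoffSum]
      have : |∑ k ∈ range n, s.indicator (fun _ => c) (T^[k] ω)| ≤ n * |c| := by
        refine (abs_sum_le_sum_abs _ _).trans ((sum_le_card_nsmul _ _ |c| ?_).trans (by simp))
        intro k _
        by_cases h : T^[k] ω ∈ s <;> simp [h]
      rcases n.eq_zero_or_pos with rfl | hn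
      · simp
      · rw [abs_of_nonneg (by positivity), inv_mul_le_iff₀ (by positivity)]
        exact this
    have avg : ∀ q : ℝ≥0∞, ∀ [Fact (1 ≤ q)] (n : ℕ), ((birkhoffAverage ℝ
        (Lp.compMeasurePreservingₗᵢ ℝ T hT) _root_.id n
        (Lp.simpleFunc.indicatorConst q hs hμs.ne c : Lp ℝ q μ) : Lp ℝ q μ) : Ω → ℝ) =ᵐ[μ]
        birkhoffAverage ℝ T (s.indicator fun _ => c) n := by
      intro q _ n
      refine (coeFn_birkhoffAverage_compMeasurePreserving hT _ n).trans ?_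
      have h : ∀ᵐ ω ∂μ, ∀ k, ((Lp.simpleFunc.indicatorConst q hs hμs.ne c :
        Lp ℝ q μ) : Ω → ℝ) (T^[k] ω) = s.indicator (fun _ => c) (T^[k] ω) :=
        ae_all_iff.2 fun k => (hT.iterate k).quasiMeasurePreserving.ae (e q)
      filter_upwards [h] with ω hω
      simp only [birkhoffAverage, birkhoffSum, hω]
    have h2 : CauchySeq fun n => birkhoffAverage ℝ
        (Lp.compMeasurePreservingₗᵢ ℝ T hT) _root_.id n
        (Lp.simpleFunc.indicatorConst 2 hs hμs.ne c : Lp ℝ 2 μ) :=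
      cauchySeq_birkhoffAverage_compMeasurePreserving_two hT _
    have hmeas : ∀ n, AEStronglyMeasurable
        (birkhoffAverage ℝ T (s.indicator fun _ => c) n) μ := fun n =>
      (Lp.aestronglyMeasurable _).congr (avg p n)
    have hd : ∀ q : ℝ≥0∞, ∀ [Fact (1 ≤ q)] (n : ℕ × ℕ), dist
        (birkhoffAverage ℝ (Lp.compMeasurePreservingₗᵢ ℝ T hT) _root_.id n.1
          (Lp.simpleFunc.indicatorConst q hs hμs.ne c : Lp ℝ q μ))
        (birkhoffAverage ℝ (Lp.compMeasurePreservingₗᵢ ℝ T hT) _root_.id n.2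
          (Lp.simpleFunc.indicatorConst q hs hμs.ne c : Lp ℝ q μ)) =
        (eLpNorm (birkhoffAverage ℝ T (s.indicator fun _ => c) n.1 -
          birkhoffAverage ℝ T (s.indicator fun _ => c) n.2) q μ).toReal := by
      intro q _ n
      rw [Lp.dist_def]
      congr 1
      exact eLpNorm_congr_ae ((avg q n.1).sub (avg q n.2))
    rw [cauchySeq_iff_tendsto_dist_atTop_0] at h2 ⊢
    simp only [hd] at h2 ⊢
    have hfin : ∀ n : ℕ × ℕ, eLpNorm (birkhoffAverage ℝ T (s.indicator fun _ => c) n.1 -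
          birkhoffAverage ℝ T (s.indicator fun _ => c) n.2) 2 μ ≠ ∞ := fun n => by
      refine (MemLp.of_bound ((hmeas n.1).sub (hmeas n.2)) (|c| + |c|)
        (Eventually.of_forall fun ω => ?_)).eLpNorm_ne_top
      exact (abs_sub _ _).trans (add_le_add (bd _ _) (bd _ _))
    have h3 : Tendsto (fun n : ℕ × ℕ => eLpNorm (birkhoffAverage ℝ T (s.indicator fun _ => c) n.1 -
          birkhoffAverage ℝ T (s.indicator fun _ => c) n.2) 2 μ) atTop (𝓝 0) := by
      rw [← ENNReal.tendsto_toReal_iff hfin ENNReal.zero_ne_top]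
      exact h2
    have h4 := tendsto_eLpNorm_zero_of_bounded hp (K := |c| + |c|)
      (fun n : ℕ × ℕ => (hmeas n.1).sub (hmeas n.2))
      (fun n => Eventually.of_forall fun ω =>
        (abs_sub _ _).trans (add_le_add (bd _ _) (bd _ _))) h3
    simpa [Function.comp_def] using (ENNReal.tendsto_toReal ENNReal.zero_ne_top).comp h4
  | add hf hg _ h1 h2 =>
    have : (fun n => birkhoffAverage ℝ (Lp.compMeasurePreservingₗᵢ ℝ T hT) _root_.id n
        (hf.toLp _ + hg.toLp _)) = (fun n => birkhoffAverage ℝ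
          (Lp.compMeasurePreservingₗᵢ ℝ T hT) _root_.id n (hf.toLp _)) +
        fun n => birkhoffAverage ℝ (Lp.compMeasurePreservingₗᵢ ℝ T hT) _root_.id n (hg.toLp _) := by
      ext1 n
      simp only [birkhoffAverage, birkhoffSum, _root_.id, iterate_map_add, sum_add_distrib,
        smul_add, Pi.add_apply]
    rw [this]
    exact h1.add h2
  | isClosed =>
    set U := Lp.compMeasurePreservingₗᵢ (E := ℝ) (p := p) ℝ T hT
    refine isClosed_of_closure_subset fun f hf => ?_
    rw [Set.mem_ofPred_eq, Metric.cauchySeq_iff']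
    intro ε hε
    obtain ⟨g, hg, hfg⟩ := Metric.mem_closure_iff.1 hf (ε / 3) (by positivity)
    obtain ⟨N, hN⟩ := Metric.cauchySeq_iff'.1 hg (ε / 3) (by positivity)
    refine ⟨N, fun n hn => ?_⟩
    -- Averaging along an isometry does not increase distances, so the Cauchy property survives
    -- limits by an ε/3 argument.
    have hle : ∀ n, dist (birkhoffAverage ℝ U _root_.id n f)
        (birkhoffAverage ℝ U _root_.id n g) ≤ dist f g := by
      intro n
      refine (dist_birkhoffAverage_birkhoffAverage_le ℝ _ _ n f g).trans ?_
      have hd : ∀ k, dist (U^[k] f) (U^[k] g) = dist f g := fun k =>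
        by
        induction k with
        | zero => rfl
        | succ k ih => rw [Function.iterate_succ_apply', Function.iterate_succ_apply',
            U.isometry.dist_eq, ih]
      simp only [_root_.id, hd, sum_const, card_range, nsmul_eq_mul]
      rcases n.eq_zero_or_pos with rfl | hn
      · simp
      · field_simp; rfl
    calc dist (birkhoffAverage ℝ U _root_.id n f) (birkhoffAverage ℝ U _root_.id N f)
        ≤ dist (birkhoffAverage ℝ U _root_.id n f) (birkhoffAverage ℝ U _root_.id n g) +
          dist (birkhoffAverage ℝ U _root_.id n g) (birkhoffAverage ℝ U _root_.id N g) +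
          dist (birkhoffAverage ℝ U _root_.id N g) (birkhoffAverage ℝ U _root_.id N f) :=
          dist_triangle4 _ _ _ _
      _ < ε / 3 + ε / 3 + ε / 3 := by
          have h1 := hle n
          have h2 := hle N
          rw [dist_comm] at h2
          have h3 := hN n hn
          linarith
      _ = ε := by ring

/-- Preimages of measurable sets are invariant up to null sets, so ergodicity makes each of them
null or conull; countably many such sets separate the values. -/
theorem ae_eq_const_of_forall_vadd_ae_eq (G : Type*) {Ω X : Type*} {mΩ : MeasurableSpace Ω}
    {μ : Measure Ω} [VAdd G Ω] [ErgodicVAdd G Ω μ] [Nonempty X] [MeasurableSpace X]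
    [MeasurableSpace.CountablySeparated X] {g : Ω → X} (hg : NullMeasurable g μ)
    (h : ∀ x : G, (fun ω => g (x +ᵥ ω)) =ᵐ[μ] g) : ∃ c, g =ᵐ[μ] Function.const Ω c := by
  refine exists_eventuallyEq_const_of_forall_separating MeasurableSet fun s hs => ?_
  refine eventuallyConst_pred.1 (aeconst_of_forall_preimage_vadd_ae_eq G (s := g ⁻¹' s) (hg hs)
    fun x => ?_)
  refine ((h x).mono fun ω hω => ?_).set_eq
  exact iff_of_eq (congrArg (· ∈ s) hω)

/-! ### Sublinear growth of cocycles along rays -/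

section Cocycle

variable {G Ω : Type*} {mΩ : MeasurableSpace Ω} {μ : Measure Ω} {p : ℝ≥0∞}

theorem abs_integral_le_norm_Lp [IsProbabilityMeasure μ] [hp1 : Fact (1 ≤ p)] (f : Lp ℝ p μ) :
    |∫ ω, f ω ∂μ| ≤ ‖f‖ := by
  rw [← Real.norm_eq_abs, ← toReal_enorm, Lp.norm_def]
  refine ENNReal.toReal_mono (Lp.eLpNorm_ne_top f) ?_
  refine (enorm_integral_le_lintegral_enorm _).trans ?_
  rw [← eLpNorm_one_eq_lintegral_enorm]
  exact eLpNorm_le_eLpNorm_of_exponent_le hp1.out (Lp.aestronglyMeasurable f)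

variable [AddCommGroup G] [AddAction G Ω] [MeasurableConstVAdd G Ω] [ErgodicVAdd G Ω μ]
  [IsProbabilityMeasure μ]

/-- A mean-zero `L^p` cocycle over an ergodic action grows sublinearly in `L^p` along each ray. -/
theorem tendsto_norm_cocycle_nsmul [hp1 : Fact (1 ≤ p)] (hp : p ≠ ∞) {V : G → Ω → ℝ}
    (hV : ∀ x, MemLp (V x) p μ)
    (hc : ∀ x y, V (x + y) =ᵐ[μ] fun ω => V x ω + V y (x +ᵥ ω))
    (h0 : ∀ x, ∫ ω, V x ω ∂μ = 0) (y : G) :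
    Tendsto (fun n : ℕ => (n : ℝ)⁻¹ * (eLpNorm (V (n • y)) p μ).toReal) atTop (𝓝 0) := by
  set v : G → Lp ℝ p μ := fun x => (hV x).toLp (V x) with hv
  set U : G → Lp ℝ p μ →ₗᵢ[ℝ] Lp ℝ p μ := fun x =>
    Lp.compMeasurePreservingₗᵢ ℝ (x +ᵥ ·) (measurePreserving_vadd x μ) with hU
  have hcoc : ∀ x y, v (x + y) = v x + U x (v y) := fun x y =>
    MemLp.toLp_congr (hV (x + y))
      ((hV x).add ((hV y).comp_measurePreserving (measurePreserving_vadd x μ))) (hc x y)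
  have hv0 : v 0 = 0 := by
    have h := hcoc 0 0
    rw [add_zero, left_eq_add] at h
    rw [← norm_eq_zero, ← (U 0).norm_map, h, norm_zero]
  have hsum : ∀ n : ℕ, v (n • y) = birkhoffSum (U y) _root_.id n (v y) := by
    intro n
    induction n with
    | zero => simp [hv0]
    | succ n ih =>
      rw [succ_nsmul', hcoc, ih, birkhoffSum_succ']
      simp only [birkhoffSum, map_sum, _root_.id, ← Function.iterate_succ_apply',
        ← Function.iterate_succ_apply]
  obtain ⟨h, hh⟩ := cauchySeq_tendsto_of_complete
    (cauchySeq_birkhoffAverage_compMeasurePreserving hp (measurePreserving_vadd y μ) (v y))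
  have hb : Tendsto (fun n : ℕ => (n : ℝ)⁻¹ • v (n • y)) atTop (𝓝 h) := by
    simp only [hsum]
    exact hh
  -- The shift by y alone need not be ergodic, so the limit has to be invariant under the whole
  -- group. Expanding v (x + n • y) in both orders shows that applying `U x` changes v (n • y) only
  -- by a term bounded in norm, which vanishes after division by n.
  have hinv : ∀ x, U x h = h := by
    intro x
    have h1 : Tendsto (fun n : ℕ => (n : ℝ)⁻¹ • (U (n • y) (v x) - v x)) atTop (𝓝 0) := by
      refine squeeze_zero_norm (a := fun n : ℕ => (n : ℝ)⁻¹ * (‖v x‖ + ‖v x‖)) (fun n => ?_) ?_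
      · rw [norm_smul, Real.norm_of_nonneg (by positivity)]
        gcongr
        exact (norm_sub_le _ _).trans (by rw [(U _).norm_map])
      · simpa using (tendsto_natCast_atTop_atTop (R := ℝ)).inv_tendsto_atTop.mul_const
          (‖v x‖ + ‖v x‖)
    have h2 : ∀ n : ℕ, U x ((n : ℝ)⁻¹ • v (n • y)) = (n : ℝ)⁻¹ • v (n • y) +
        (n : ℝ)⁻¹ • (U (n • y) (v x) - v x) := by
      intro n
      rw [map_smul, ← smul_add]
      congr 1
      have h3 := hcoc x (n • y)
      rw [add_comm, hcoc] at h3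
      rw [add_sub, h3]
      abel
    have h3 := ((U x).continuous.tendsto h).comp hb
    simp only [Function.comp_def, h2] at h3
    have h4 := hb.add h1
    rw [add_zero] at h4
    exact tendsto_nhds_unique h3 h4
  obtain ⟨c, hcst⟩ := ae_eq_const_of_forall_vadd_ae_eq G (g := (h : Ω → ℝ))
    (Lp.aestronglyMeasurable h).aemeasurable.nullMeasurable fun x => by
      have h1 : (U x h : Ω → ℝ) =ᵐ[μ] h ∘ (x +ᵥ ·) := Lp.coeFn_compMeasurePreserving h _
      rw [hinv x] at h1
      exact h1.symm
  have hc0 : c = 0 := by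
    have h1 : ∀ n : ℕ, |c| ≤ ‖h - (n : ℝ)⁻¹ • v (n • y)‖ := by
      intro n
      refine le_trans (le_of_eq ?_) (abs_integral_le_norm_Lp _)
      congr 1
      have h2 : ((h - (n : ℝ)⁻¹ • v (n • y) : Lp ℝ p μ) : Ω → ℝ) =ᵐ[μ]
          fun ω => c - (n : ℝ)⁻¹ * V (n • y) ω := by
        filter_upwards [Lp.coeFn_sub h ((n : ℝ)⁻¹ • v (n • y)), hcst,
          Lp.coeFn_smul (n : ℝ)⁻¹ (v (n • y)), (hV (n • y)).coeFn_toLp] with ω h1 h2 h3 h4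
        rw [h1, Pi.sub_apply, h2, h3, Pi.smul_apply, h4]
        rfl
      rw [integral_congr_ae h2, integral_sub (integrable_const _)
        (((hV (n • y)).integrable hp1.out).const_mul _), integral_const_mul, h0]
      simp
    have h2 : Tendsto (fun n : ℕ => ‖h - (n : ℝ)⁻¹ • v (n • y)‖) atTop (𝓝 0) := by
      simpa using ((tendsto_const_nhds (x := h)).sub hb).norm
    exact abs_eq_zero.1 (le_antisymm (ge_of_tendsto' h2 h1) (abs_nonneg _))
  have hz : h = 0 := by
    refine Lp.ext (hcst.trans ?_)
    filter_upwards [Lp.coeFn_zero ℝ p μ] with ω hω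
    rw [hω, hc0]
    rfl
  rw [hz] at hb
  refine hb.norm.congr' (Eventually.of_forall fun n => ?_) |>.trans (by simp)
  rw [norm_smul, Real.norm_of_nonneg (by positivity), Lp.norm_toLp]

end Cocycle

end MeasureTheory

/-! ### Almost sure sublinearity by dyadic chaining -/

theorem tendsto_sum_range_pow_mul {ρ : ℝ} (h0 : 0 ≤ ρ) (h1 : ρ < 1) {b : ℕ → ℝ}
    (hb : Tendsto b atTop (𝓝 0)) :
    Tendsto (fun m => ∑ i ∈ range m, ρ ^ (m - i) * b i) atTop (𝓝 0) := by
  obtain ⟨C, hC⟩ := hb.norm.bddAbove_range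
  have hC' : ∀ i, |b i| ≤ C := fun i => hC ⟨i, rfl⟩
  have hC0 : 0 ≤ C := (abs_nonneg _).trans (hC' 0)
  -- Reversing the sum puts the geometric weight in the summation index, so that dominated
  -- convergence for series applies.
  have e : ∀ m, ∑ i ∈ range m, ρ ^ (m - i) * b i =
      ∑' k, if k < m then ρ ^ (k + 1) * b (m - 1 - k) else 0 := by
    intro m
    rw [tsum_eq_sum (s := range m) (fun k hk => if_neg (by simpa using hk)),
      ← sum_range_reflect]
    refine sum_congr rfl fun k hk => ?_
    have := mem_range.1 hk
    rw [if_pos this, show m - (m - 1 - k) = k + 1 by omega]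
  simp only [e]
  have h := tendsto_tsum_of_dominated_convergence (𝓕 := atTop)
    (f := fun m k => if k < m then ρ ^ (k + 1) * b (m - 1 - k) else 0) (g := fun _ => 0)
    (bound := fun k => ρ ^ (k + 1) * C)
    (((summable_nat_add_iff 1).2 (summable_geometric_of_lt_one h0 h1)).mul_right C) ?_ ?_
  · simpa using h
  · intro k
    have h2 : Tendsto (fun m => ρ ^ (k + 1) * b (m - 1 - k)) atTop (𝓝 (ρ ^ (k + 1) * 0)) := by
      refine Tendsto.const_mul _ (hb.comp ?_)
      simp only [Nat.sub_sub]
      exact tendsto_sub_atTop_nat _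
    rw [mul_zero] at h2
    refine h2.congr' ?_
    filter_upwards [eventually_gt_atTop k] with m hm
    rw [if_pos hm]
  · refine Eventually.of_forall fun m k => ?_
    split_ifs
    · rw [norm_mul, Real.norm_of_nonneg (by positivity)]
      gcongr
      exact hC' _
    · simpa using by positivity

namespace MeasureTheory

section Chaining

variable {Ω : Type*} {mΩ : MeasurableSpace Ω} {μ : Measure Ω} {q : ℝ}

/-- The ℓ^q norm of the family dominates its maximum, and its L^q norm costs only the factor
card^(1/q). -/
theorem exists_dominating_finset (hq : 0 < q) {κ : Type*} (s : Finset κ) {f : κ → Ω → ℝ}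
    (hf : ∀ k, AEStronglyMeasurable (f k) μ) {a : ℝ}
    (hfa : ∀ k ∈ s, eLpNorm (f k) (ENNReal.ofReal q) μ ≤ ENNReal.ofReal a) :
    ∃ g : Ω → ℝ, AEStronglyMeasurable g μ ∧ (∀ ω, ∀ k ∈ s, |f k ω| ≤ g ω) ∧
      eLpNorm g (ENNReal.ofReal q) μ ≤ ENNReal.ofReal ((s.card : ℝ) ^ (1 / q) * a) := by
  refine ⟨fun ω => (∑ k ∈ s, |f k ω| ^ q) ^ (1 / q), ?_, fun ω k hk => ?_, ?_⟩
  · refine ((AEMeasurable.pow_const (Finset.aemeasurable_fun_sum _ fun k _ => ?_)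
      _)).aestronglyMeasurable
    exact ((hf k).aemeasurable.abs).pow_const _
  · calc |f k ω| = (|f k ω| ^ q) ^ (1 / q) := by
          rw [← Real.rpow_mul (abs_nonneg _), mul_one_div_cancel hq.ne', Real.rpow_one]
      _ ≤ _ := by
          refine Real.rpow_le_rpow (by positivity) ?_ (by positivity)
          exact single_le_sum (f := fun k => |f k ω| ^ q) (fun i _ => by positivity) hk
  · have hq' : ENNReal.ofReal q ≠ 0 := by simpa using hq
    have e : ∀ u : Ω → ℝ, eLpNorm u (ENNReal.ofReal q) μ =
        (∫⁻ ω, ‖u ω‖ₑ ^ q ∂μ) ^ (1 / q) := fun u => by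
      rw [eLpNorm_eq_lintegral_rpow_enorm_toReal hq' ENNReal.ofReal_ne_top,
        ENNReal.toReal_ofReal hq.le]
    have h1 : ∀ ω, ‖(∑ k ∈ s, |f k ω| ^ q) ^ (1 / q)‖ₑ ^ q = ∑ k ∈ s, ‖f k ω‖ₑ ^ q := by
      intro ω
      have hn : 0 ≤ ∑ k ∈ s, |f k ω| ^ q := sum_nonneg fun _ _ => by positivity
      rw [Real.enorm_of_nonneg (by positivity), ENNReal.ofReal_rpow_of_nonneg (by positivity) hq.le,
        ← Real.rpow_mul hn, one_div_mul_cancel hq.ne', Real.rpow_one,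
        ENNReal.ofReal_sum_of_nonneg fun _ _ => by positivity]
      refine sum_congr rfl fun k _ => ?_
      rw [Real.enorm_eq_ofReal_abs, ENNReal.ofReal_rpow_of_nonneg (abs_nonneg _) hq.le]
    rw [e]
    simp only [h1]
    rw [lintegral_finsetSum' _ fun k _ => (hf k).enorm.pow_const q]
    have h2 : ∀ k ∈ s, ∫⁻ ω, ‖f k ω‖ₑ ^ q ∂μ ≤ ENNReal.ofReal a ^ q := by
      intro k hk
      have h3 := ENNReal.rpow_le_rpow (hfa k hk) hq.le
      rwa [e, ← ENNReal.rpow_mul, one_div_mul_cancel hq.ne', ENNReal.rpow_one] at h3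
    calc (∑ k ∈ s, ∫⁻ ω, ‖f k ω‖ₑ ^ q ∂μ) ^ (1 / q)
        ≤ ((s.card : ℝ≥0∞) * ENNReal.ofReal a ^ q) ^ (1 / q) := by
          gcongr
          simpa using sum_le_card_nsmul s _ _ h2
      _ = ENNReal.ofReal ((s.card : ℝ) ^ (1 / q) * a) := by
          rw [ENNReal.mul_rpow_of_nonneg _ _ (by positivity), ← ENNReal.rpow_mul,
            mul_one_div_cancel hq.ne', ENNReal.rpow_one, ENNReal.ofReal_mul (by positivity),
            ← ENNReal.ofReal_rpow_of_nonneg (by positivity) (by positivity), ENNReal.ofReal_natCast]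

variable {ι : Type*} [Fintype ι] [DecidableEq ι]

/-- The box `{0, …, n - 1}^ι`. -/
noncomputable def latticeBox (ι : Type*) [Fintype ι] [DecidableEq ι] (n : ℤ) : Finset (ι → ℤ) :=
  Fintype.piFinset fun _ => Finset.Ico 0 n

theorem mem_latticeBox {n : ℤ} {x : ι → ℤ} : x ∈ latticeBox ι n ↔ ∀ i, 0 ≤ x i ∧ x i < n := by
  simp [latticeBox]

theorem card_latticeBox (n : ℕ) : (latticeBox ι n).card = n ^ Fintype.card ι := by
  simp [latticeBox]

variable [AddAction (ι → ℤ) Ω] [MeasurableConstVAdd (ι → ℤ) Ω]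
  [VAddInvariantMeasure (ι → ℤ) Ω μ]

/-- Dyadic chaining: the maximum of an `L^q` cocycle over a dyadic box is controlled by its values
on the vertices of dyadic cubes. -/
theorem exists_dominating_cocycle_latticeBox (hq : 1 ≤ q) {V : (ι → ℤ) → Ω → ℝ}
    (hV : ∀ x, MemLp (V x) (ENNReal.ofReal q) μ)
    (hc : ∀ᵐ ω ∂μ, ∀ x y, V (x + y) ω = V x ω + V y (x +ᵥ ω)) {a : ℕ → ℝ} (ha : ∀ j, 0 ≤ a j)
    (hVa : ∀ j, ∀ e ∈ latticeBox ι 2,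
      eLpNorm (V (2 ^ j • e)) (ENNReal.ofReal q) μ ≤ ENNReal.ofReal (a j)) (m j : ℕ) :
    ∃ g : Ω → ℝ, AEStronglyMeasurable g μ ∧
      (∀ᵐ ω ∂μ, ∀ y ∈ latticeBox ι (2 ^ m), |V (2 ^ j • y) ω| ≤ g ω) ∧
      eLpNorm g (ENNReal.ofReal q) μ ≤ ENNReal.ofReal
        (∑ i ∈ range m, ((2 : ℝ) ^ ((Fintype.card ι : ℝ) / q)) ^ (m - i) * a (j + i)) := by
  have hq0 : 0 < q := by linarith
  induction m generalizing j with
  | zero =>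
    refine ⟨fun _ => 0, aestronglyMeasurable_const, ?_, by simp⟩
    filter_upwards [hc] with ω hω y hy
    have hy0 : y = 0 := funext fun i => by
      have := mem_latticeBox.1 hy i
      simp only [pow_zero, Pi.zero_apply] at this ⊢
      omega
    have h := hω 0 0
    rw [zero_vadd, add_zero, left_eq_add] at h
    simp [hy0, h]
  | succ m ih =>
    obtain ⟨g, hg, hgV, hgn⟩ := ih (j + 1)
    -- The quotient z / 2 is handled at scale j + 1 by induction. The remainder z % 2 contributes
    -- one increment, based at one of 2^(m d) points with one of 2^d directions, where d is the
    -- cardinality of ι; the maximum over these costs (2^(d / q))^(m + 1).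
    obtain ⟨g', hg', hgV', hgn'⟩ := exists_dominating_finset hq0
      (latticeBox ι (2 ^ m) ×ˢ latticeBox ι 2)
      (f := fun k ω => V (2 ^ j • k.2) ((2 ^ (j + 1) • k.1) +ᵥ ω)) (μ := μ) (a := a j)
      (fun k => (hV _).aestronglyMeasurable.comp_measurePreserving (measurePreserving_vadd _ μ))
      (fun k hk => by
        refine le_trans (le_of_eq ?_) (hVa j k.2 (mem_product.1 hk).2)
        exact eLpNorm_comp_measurePreserving (hV _).aestronglyMeasurable
          (measurePreserving_vadd _ μ))
    refine ⟨fun ω => g ω + g' ω, hg.add hg', ?_, ?_⟩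
    · filter_upwards [hgV, hc] with ω h1 h2 z hz
      have hz' := mem_latticeBox.1 hz
      have hy : (fun i => z i / 2) ∈ latticeBox ι (2 ^ m) := mem_latticeBox.2 fun i => by
        have := hz' i
        rw [pow_succ] at this
        omega
      have he : (fun i => z i % 2) ∈ latticeBox ι 2 := mem_latticeBox.2 fun i => by omega
      have hzz : 2 ^ j • z = 2 ^ (j + 1) • (fun i => z i / 2) + 2 ^ j • (fun i => z i % 2) := by
        ext i
        rw [Pi.smul_apply, Pi.add_apply, Pi.smul_apply, Pi.smul_apply]
        simp only [nsmul_eq_mul]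
        push_cast
        have := Int.mul_ediv_add_emod (z i) 2
        calc (2 : ℤ) ^ j * z i = 2 ^ j * (2 * (z i / 2) + z i % 2) := by rw [this]
          _ = _ := by ring
      rw [hzz, h2]
      refine (abs_add_le _ _).trans (add_le_add (h1 _ hy) ?_)
      exact hgV' ω (_, _) (mem_product.2 ⟨hy, he⟩)
    · refine (eLpNorm_add_le hg hg' (by simpa using hq)).trans
        ((add_le_add hgn hgn').trans (le_of_eq ?_))
      rw [← ENNReal.ofReal_add, sum_range_succ']
      · congr 1
        congr 1
        · refine sum_congr rfl fun i _ => ?_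
          rw [show m + 1 - (i + 1) = m - i by omega, show j + 1 + i = j + (i + 1) by omega]
        · rw [add_zero, Nat.sub_zero]
          congr 1
          have h2 : (latticeBox ι (2 ^ m)).card = (2 ^ m) ^ Fintype.card ι := by
            exact_mod_cast card_latticeBox (ι := ι) (2 ^ m)
          have h3 : (latticeBox ι 2).card = 2 ^ Fintype.card ι := by
            exact_mod_cast card_latticeBox (ι := ι) 2
          rw [card_product, h2, h3, ← mul_pow, ← pow_succ]
          push_cast
          rw [← Real.rpow_natCast, ← Real.rpow_natCast, ← Real.rpow_natCast, ← Real.rpow_mul,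
            ← Real.rpow_mul, ← Real.rpow_mul] <;> try positivity
          congr 1
          push_cast
          field_simp
      · exact sum_nonneg fun i _ => mul_nonneg (by positivity) (ha _)
      · exact mul_nonneg (by positivity) (ha _)

end Chaining

/-- A mean-zero `L^q` cocycle over an ergodic `ℤ^d`-action with `q > d` is almost surely sublinear
on boxes, along a subsequence of dyadic scales. -/
theorem exists_seq_cocycle_sublinear {ι Ω : Type*} [Fintype ι] {mΩ : MeasurableSpace Ω}
    {μ : Measure Ω} [IsProbabilityMeasure μ] [AddAction (ι → ℤ) Ω]
    [MeasurableConstVAdd (ι → ℤ) Ω] [ErgodicVAdd (ι → ℤ) Ω μ] {q : ℝ} (hq : 1 ≤ q)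
    (hdq : (Fintype.card ι : ℝ) < q) {V : (ι → ℤ) → Ω → ℝ}
    (hV : ∀ x, MemLp (V x) (ENNReal.ofReal q) μ)
    (hc : ∀ᵐ ω ∂μ, ∀ x y, V (x + y) ω = V x ω + V y (x +ᵥ ω))
    (h0 : ∀ x, ∫ ω, V x ω ∂μ = 0) :
    ∃ φ : ℕ → ℕ, StrictMono φ ∧ ∀ᵐ ω ∂μ, ∀ ε > 0, ∀ᶠ k in atTop, ∀ x : ι → ℤ,
      (∀ i, |x i| < 2 ^ φ k) → |V x ω| ≤ ε * 2 ^ φ k := by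
  classical
  have hq0 : 0 < q := by linarith
  have : Fact (1 ≤ ENNReal.ofReal q) := ⟨by simpa using hq⟩
  have hc' : ∀ x y, V (x + y) =ᵐ[μ] fun ω => V x ω + V y (x +ᵥ ω) := fun x y => by
    filter_upwards [hc] with ω hω using hω x y
  set a : ℕ → ℝ := fun j => ∑ e ∈ latticeBox ι 2,
    (eLpNorm (V (2 ^ j • e)) (ENNReal.ofReal q) μ).toReal with ha
  have ha0 : ∀ j, 0 ≤ a j := fun j => sum_nonneg fun _ _ => ENNReal.toReal_nonneg
  have hVa : ∀ j, ∀ e ∈ latticeBox ι 2,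
      eLpNorm (V (2 ^ j • e)) (ENNReal.ofReal q) μ ≤ ENNReal.ofReal (a j) := by
    intro j e he
    rw [← ENNReal.ofReal_toReal (hV _).eLpNorm_ne_top]
    exact ENNReal.ofReal_le_ofReal (single_le_sum
      (f := fun e => (eLpNorm (V (2 ^ j • e)) (ENNReal.ofReal q) μ).toReal)
      (fun _ _ => ENNReal.toReal_nonneg) he)
  have hat : Tendsto (fun j => ((2 : ℝ) ^ j)⁻¹ * a j) atTop (𝓝 0) := by
    simp only [ha, mul_sum]
    rw [← sum_const_zero (s := latticeBox ι 2) (M := ℝ)]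
    refine tendsto_finsetSum _ fun e _ => ?_
    have h1 := (tendsto_norm_cocycle_nsmul ENNReal.ofReal_ne_top hV hc' h0 e).comp
      (tendsto_pow_atTop_atTop_of_one_lt (r := 2) (by norm_num))
    refine h1.congr fun j => ?_
    simp
  set K : ℝ := (2 : ℝ) ^ ((Fintype.card ι : ℝ) / q) with hK
  -- Here q > d enters: the cost per dyadic scale of taking maxima stays below the factor 2 by which
  -- lengths grow.
  have hK2 : K < 2 := by
    calc K < (2 : ℝ) ^ (1 : ℝ) :=
          Real.rpow_lt_rpow_of_exponent_lt (by norm_num) ((div_lt_one hq0).2 hdq)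
      _ = 2 := by norm_num
  have hK0 : 0 ≤ K := by positivity
  have hst := tendsto_sum_range_pow_mul (ρ := K / 2) (by positivity)
    (by linarith) hat
  set s : ℕ → ℝ := fun m => ∑ i ∈ range m, (K / 2) ^ (m - i) * (((2 : ℝ) ^ i)⁻¹ * a i) with hs
  have hs0 : ∀ m, 0 ≤ s m := fun m => sum_nonneg fun i _ => by
    have := ha0 i
    positivity
  have hsum : ∀ m, ∑ i ∈ range m, K ^ (m - i) * a (0 + i) = 2 ^ m * s m := by
    intro m
    rw [hs, mul_sum]
    refine sum_congr rfl fun i hi => ?_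
    have : (2 : ℝ) ^ m = 2 ^ (m - i) * 2 ^ i := by
      rw [← pow_add, Nat.sub_add_cancel (mem_range.1 hi).le]
    rw [zero_add, this, div_pow]
    field_simp
  choose g hg hgV hgn using fun m =>
    exists_dominating_cocycle_latticeBox hq hV hc ha0 hVa m 0
  simp only [pow_zero, one_smul, ← hK, hsum] at hgV hgn
  -- The chaining bound concerns boxes with corner 0. Seen from the corner b, the cube |x i| < 2^m
  -- lies in a box of side 2^(m + 1), and V x is the difference of two values there; hence the
  -- factor 2 in h.
  set b : ℕ → ι → ℤ := fun m _ => -2 ^ m with hb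
  set h : ℕ → Ω → ℝ := fun m ω => (2 * ((2 : ℝ) ^ m)⁻¹) * g (m + 1) (b m +ᵥ ω) with hh
  have hbound : ∀ᵐ ω ∂μ, ∀ m, ∀ x : ι → ℤ, (∀ i, |x i| < 2 ^ m) → |V x ω| ≤ h m ω * 2 ^ m := by
    have h1 : ∀ᵐ ω ∂μ, ∀ m, ∀ y ∈ latticeBox ι (2 ^ (m + 1)),
        |V y (b m +ᵥ ω)| ≤ g (m + 1) (b m +ᵥ ω) := ae_all_iff.2 fun m =>
      (measurePreserving_vadd (b m) μ).quasiMeasurePreserving.ae (hgV (m + 1))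
    filter_upwards [h1, hc] with ω h2 h3 m x hx
    have hm : (0 : ℤ) < 2 ^ m := by positivity
    have hz : V 0 ω = 0 := by
      have := h3 0 0
      rwa [zero_vadd, add_zero, left_eq_add] at this
    have e1 := h3 (b m) (x - b m)
    have e2 := h3 (b m) (-b m)
    rw [add_sub_cancel] at e1
    rw [add_neg_cancel, hz] at e2
    have i1 := h2 m (x - b m) (mem_latticeBox.2 fun i => by
      have := abs_lt.1 (hx i)
      simp only [Pi.sub_apply, hb, pow_succ]
      omega)
    have i2 := h2 m (-b m) (mem_latticeBox.2 fun i => by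
      simp only [Pi.neg_apply, hb, pow_succ]
      omega)
    have e3 : h m ω * 2 ^ m = 2 * g (m + 1) (b m +ᵥ ω) := by
      simp only [hh]
      field_simp
    have e4 : V x ω = V (x - b m) (b m +ᵥ ω) - V (-b m) (b m +ᵥ ω) := by linarith
    rw [e3, e4]
    refine (abs_sub _ _).trans ?_
    linarith
  have hmeas : ∀ m, AEStronglyMeasurable (fun ω => g (m + 1) (b m +ᵥ ω)) μ := fun m =>
    (hg _).comp_measurePreserving (measurePreserving_vadd _ μ)
  -- The constant is 2 · 2^(m + 1) / 2^m = 4.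
  have hn : ∀ m, eLpNorm (h m) (ENNReal.ofReal q) μ ≤ ENNReal.ofReal (4 * s (m + 1)) := by
    intro m
    have e : h m = (2 * ((2 : ℝ) ^ m)⁻¹) • (g (m + 1) ∘ (b m +ᵥ ·)) := rfl
    rw [e, eLpNorm_const_smul, eLpNorm_comp_measurePreserving (hg _)
      (measurePreserving_vadd _ μ), Real.enorm_of_nonneg (by positivity)]
    refine (mul_le_mul_right (hgn _) _).trans (le_of_eq ?_)
    rw [← ENNReal.ofReal_mul (by positivity)]
    congr 1
    field_simp
    ring
  have hlim : Tendsto (fun m => eLpNorm (h m - 0) (ENNReal.ofReal q) μ) atTop (𝓝 0) := by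
    simp only [sub_zero]
    refine tendsto_of_tendsto_of_tendsto_of_le_of_le tendsto_const_nhds ?_ (fun _ => zero_le) hn
    have h1 := ENNReal.tendsto_ofReal (((tendsto_add_atTop_iff_nat 1).2 hst).const_mul 4)
    simpa using h1
  -- L^q convergence gives almost sure convergence only along a subsequence, which is all that is
  -- needed later.
  obtain ⟨φ, hφ, hae⟩ := (tendstoInMeasure_of_tendsto_eLpNorm (by simpa using hq0)
    (fun m => (hmeas m).const_mul _) aestronglyMeasurable_const hlim).exists_seq_tendsto_ae
  refine ⟨φ, hφ, ?_⟩
  filter_upwards [hae, hbound] with ω h1 h2 ε hε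
  filter_upwards [h1.eventually (gt_mem_nhds (show (0 : Ω → ℝ) ω < ε from hε))] with k hk x hx
  exact (h2 (φ k) x hx).trans (by gcongr)

end MeasureTheory

/-! ### Paths of allowed steps and the potential of a function of class `𝒦` -/

namespace RWRE

variable {d B : ℕ}

instance : MeasurableConstVAdd (Fin d → ℤ) (Env d) :=
  ⟨fun z => (continuous_shift z).measurable⟩

theorem abs_step_le (z : steps d B) (i : Fin d) : |z.1 i| ≤ B :=
  (single_le_sum (f := fun i => |z.1 i|) (fun _ _ => abs_nonneg _) (mem_univ i)).trans z.2.2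

instance : Finite (steps d B) := by
  refine Set.Finite.subset (Finset.finite_toSet
    (Fintype.piFinset fun _ : Fin d => Finset.Icc (-(B : ℤ)) B)) fun z hz => ?_
  rw [mem_coe, Fintype.mem_piFinset]
  exact fun i => mem_Icc.2 (abs_le.1 (abs_step_le ⟨z, hz⟩ i))

/-- The sum of `F` along a path of allowed steps. -/
def pathSum (F : Env d × steps d B → ℝ) : List (steps d B) → Env d → ℝ
  | [], _ => 0
  | z :: l, ω => F (ω, z) + pathSum F l (z.1 +ᵥ ω)

/-- The endpoint of a path of allowed steps from the origin. -/
def pathEnd (l : List (steps d B)) : Fin d → ℤ := (l.map Subtype.val).sum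

@[simp]
theorem pathEnd_nil : pathEnd ([] : List (steps d B)) = 0 := rfl

@[simp]
theorem pathEnd_cons (z : steps d B) (l : List (steps d B)) :
    pathEnd (z :: l) = z.1 + pathEnd l := by simp [pathEnd]

@[simp]
theorem pathEnd_append (l l' : List (steps d B)) :
    pathEnd (l ++ l') = pathEnd l + pathEnd l' := by simp [pathEnd]

theorem pathSum_append (F : Env d × steps d B → ℝ) (l l' : List (steps d B)) (ω : Env d) :
    pathSum F (l ++ l') ω = pathSum F l ω + pathSum F l' (pathEnd l +ᵥ ω) := by
  induction l generalizing ω with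
  | nil => simp [pathSum]
  | cons z l ih =>
    rw [List.cons_append, pathSum, pathSum, ih, pathEnd_cons, add_comm z.1, add_vadd]
    ring

/-- Translates lists of steps, suited to induction, into the indexed walks in which the closed loop
condition is stated. -/
theorem exists_walk_of_path [Nonempty (steps d B)] (F : Env d × steps d B → ℝ)
    (l : List (steps d B)) (y : Fin d → ℤ) :
    ∃ (x : ℕ → Fin d → ℤ) (s : ℕ → steps d B), x 0 = y ∧ x l.length = y + pathEnd l ∧
      (∀ k < l.length, x (k + 1) - x k = s k) ∧
      ∀ ω, ∑ k ∈ range l.length, F (x k +ᵥ ω, s k) = pathSum F l (y +ᵥ ω) := by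
  induction l generalizing y with
  | nil => exact ⟨fun _ => y, fun _ => Classical.arbitrary _, rfl, by simp, by simp,
      by simp [pathSum]⟩
  | cons z l ih =>
    obtain ⟨x, s, h0, h1, h2, h3⟩ := ih (z.1 + y)
    refine ⟨fun k => Nat.casesOn k y x, fun k => Nat.casesOn k z s, rfl, ?_, ?_, fun ω => ?_⟩
    · simp only [List.length_cons, h1, pathEnd_cons]
      abel
    · rintro (_ | k) hk
      · simp [h0]
      · exact h2 k (by simpa using hk)
    · rw [List.length_cons, sum_range_succ', pathSum, ← add_vadd, ← h3]
      exact add_comm _ _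

theorem addSubmonoid_eq_top_of_single_mem {S : AddSubmonoid (Fin d → ℤ)}
    (hS : ∀ (i : Fin d) (c : ℤ), |c| = 1 → (Pi.single i c : Fin d → ℤ) ∈ S) : S = ⊤ := by
  have hsingle : ∀ (i : Fin d) (c : ℤ), (Pi.single i c : Fin d → ℤ) ∈ S := by
    intro i c
    induction c using Int.induction_on with
    | zero => rw [Pi.single_zero]; exact S.zero_mem
    | succ n ih => rw [Pi.single_add]; exact S.add_mem ih (hS i 1 (by simp))
    | pred n ih =>
      rw [sub_eq_add_neg, Pi.single_add]; exact S.add_mem ih (hS i (-1) (by simp))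
  refine (AddSubmonoid.eq_top_iff' S).2 fun x => ?_
  rw [← Finset.univ_sum_single x]
  exact S.sum_mem fun i _ => hsingle i _

theorem exists_isUnitStep_eq_single [h : Nonempty (steps d B)] (i : Fin d) {c : ℤ}
    (hc : |c| = 1) : ∃ z : steps d B, IsUnitStep z ∧ z.1 = Pi.single i c := by
  obtain ⟨z⟩ := h
  have hB : (1 : ℤ) ≤ B := by
    have h1 := z.2.1
    have h2 := z.2.2
    omega
  have hs : ∑ j, |(Pi.single i c : Fin d → ℤ) j| = 1 := by
    rw [Fintype.sum_eq_single i fun j hj => by simp [hj]]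
    simpa using hc
  exact ⟨⟨Pi.single i c, by rw [hs]; norm_num, by rw [hs]; exact hB⟩, hs, rfl⟩

theorem exists_pathEnd_eq [Nonempty (steps d B)] (x : Fin d → ℤ) :
    ∃ l : List (steps d B), pathEnd l = x := by
  let S : AddSubmonoid (Fin d → ℤ) :=
    { carrier := {x | ∃ l : List (steps d B), pathEnd l = x}
      zero_mem' := ⟨[], rfl⟩
      add_mem' := by
        rintro _ _ ⟨l, rfl⟩ ⟨l', rfl⟩
        exact ⟨l ++ l', pathEnd_append l l'⟩ }
  have hS : S = ⊤ := addSubmonoid_eq_top_of_single_mem fun i c hc => by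
    obtain ⟨z, -, hz⟩ := exists_isUnitStep_eq_single (B := B) i hc
    exact ⟨[z], by simp [hz]⟩
  have hx : x ∈ S := hS ▸ AddSubmonoid.mem_top x
  exact hx

/-- Two paths with the same endpoint are closed by one common return path. Both loops sum to zero
and share the return contribution. -/
theorem ClassK.ae_pathSum_congr [Nonempty (steps d B)] {P : Measure (Env d)}
    {F : Env d × steps d B → ℝ} (hF : ClassK P F) :
    ∀ᵐ ω ∂P, ∀ y : Fin d → ℤ, ∀ l l' : List (steps d B), pathEnd l = pathEnd l' →
      pathSum F l (y +ᵥ ω) = pathSum F l' (y +ᵥ ω) := by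
  filter_upwards [hF.closed_loop] with ω hω y
  have hloop : ∀ l : List (steps d B), pathEnd l = 0 → pathSum F l (y +ᵥ ω) = 0 := by
    intro l hl
    obtain ⟨x, s, h0, h1, h2, h3⟩ := exists_walk_of_path F l y
    rw [← h3]
    exact hω _ x s h2 (by rw [h0, h1, hl, add_zero])
  intro l l' hll
  obtain ⟨l'', hl''⟩ := exists_pathEnd_eq (B := B) (-pathEnd l)
  have h1 := hloop (l ++ l'') (by rw [pathEnd_append, hl'', add_neg_cancel])
  have h2 := hloop (l' ++ l'') (by rw [pathEnd_append, hl'', hll, add_neg_cancel])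
  rw [pathSum_append] at h1 h2
  rw [hll] at h1
  linarith

theorem measurable_pathSum {F : Env d × steps d B → ℝ} (hF : Measurable F)
    (l : List (steps d B)) : Measurable (pathSum F l) := by
  induction l with
  | nil => exact measurable_const
  | cons z l ih =>
    exact (hF.comp (measurable_id.prodMk measurable_const)).add
      (ih.comp (continuous_shift z.1).measurable)

variable {P : Measure (Env d)} [VAddInvariantMeasure (Fin d → ℤ) (Env d) P]

theorem memLp_pathSum {F : Env d × steps d B → ℝ} {p : ℝ≥0∞}
    (hF : ∀ z, MemLp (fun ω => F (ω, z)) p P) (l : List (steps d B)) :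
    MemLp (pathSum F l) p P := by
  induction l with
  | nil => exact MemLp.zero
  | cons z l ih => exact (hF z).add (ih.comp_measurePreserving (measurePreserving_vadd z.1 P))

theorem integral_pathSum_eq_zero {F : Env d × steps d B → ℝ}
    (hF : ∀ z, Integrable (fun ω => F (ω, z)) P) (h0 : ∀ z, ∫ ω, F (ω, z) ∂P = 0)
    (l : List (steps d B)) : ∫ ω, pathSum F l ω ∂P = 0 := by
  induction l with
  | nil => simp [pathSum]
  | cons z l ih =>
    have h1 : Integrable (pathSum F l) P :=
      memLp_one_iff_integrable.1 (memLp_pathSum (fun z => memLp_one_iff_integrable.2 (hF z)) l)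
    have h2 : Integrable (fun ω => pathSum F l (z.1 +ᵥ ω)) P :=
      (measurePreserving_vadd z.1 P).integrable_comp_of_integrable h1
    simp only [pathSum]
    rw [integral_add (hF z) h2, h0, integral_vadd_eq_self, ih, zero_add]

/-- A function of class `𝒦` is the gradient of a potential that is sublinear on boxes, along a
subsequence of scales. -/
theorem ClassK.exists_potential (hd : 1 ≤ d) {P : Measure (Env d)} [IsProbabilityMeasure P]
    [ErgodicVAdd (Fin d → ℤ) (Env d) P] [Nonempty (steps d B)]
    {F : Env d × steps d B → ℝ} (hF : ClassK P F) :
    ∃ V : (Fin d → ℤ) → Env d → ℝ, (∀ x, Measurable (V x)) ∧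
      (∀ᵐ ω ∂P, V 0 ω = 0 ∧ ∀ (z : steps d B) x, V (z.1 + x) ω = F (ω, z) + V x (z.1 +ᵥ ω)) ∧
      ∃ n : ℕ → ℕ, (∀ k, 0 < n k) ∧ ∀ᵐ ω ∂P, ∀ ε > 0, ∀ᶠ k in atTop, ∀ x : Fin d → ℤ,
        (∀ i, |x i| ≤ B * n k) → |V x ω| ≤ ε * n k := by
  choose path hpath using exists_pathEnd_eq (d := d) (B := B)
  choose α hα0 hα using hF.moment
  -- There are finitely many steps, so the smallest α gives one exponent q > d valid for all of
  -- them.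
  obtain ⟨z₀, hz₀⟩ := Finite.exists_min α
  have hd' : (1 : ℝ) ≤ d := by exact_mod_cast hd
  have hLp : ∀ z, MemLp (fun ω => F (ω, z)) (ENNReal.ofReal (d + α z₀)) P := fun z =>
    (hα z).mono_exponent (ENNReal.ofReal_le_ofReal (by linarith [hz₀ z]))
  have h1 : 1 ≤ (d : ℝ) + α z₀ := by linarith [hα0 z₀]
  have hgood := hF.ae_pathSum_congr
  have hcoc : ∀ᵐ ω ∂P, ∀ x y, pathSum F (path (x + y)) ω =
      pathSum F (path x) ω + pathSum F (path y) (x +ᵥ ω) := by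
    filter_upwards [hgood] with ω hω x y
    have h2 := hω 0 (path (x + y)) (path x ++ path y) (by simp [hpath])
    rwa [zero_vadd, pathSum_append, hpath] at h2
  refine ⟨fun x => pathSum F (path x), fun x => measurable_pathSum hF.measurable _, ?_, ?_⟩
  · filter_upwards [hgood] with ω hω
    constructor
    · have h2 := hω 0 (path 0) [] (by simp [hpath])
      rwa [zero_vadd] at h2
    · intro z x
      have h2 := hω 0 (path (z.1 + x)) (z :: path x) (by simp [hpath])
      rwa [zero_vadd] at h2
  · obtain ⟨φ, hφ, hsub⟩ := exists_seq_cocycle_sublinear h1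
      (by simpa using hα0 z₀) (V := fun x => pathSum F (path x)) (fun x => memLp_pathSum hLp _) hcoc
      (fun x => integral_pathSum_eq_zero (fun z => (hLp z).integrable (by simpa using h1))
        hF.mean_zero _)
    -- Dividing the dyadic scale by 2^b > B makes the box of radius B n fit inside it; ε is divided
    -- by 2^b to compensate.
    obtain ⟨b, hb⟩ : ∃ b : ℕ, B < 2 ^ b := ⟨B, Nat.lt_two_pow_self⟩
    have hle : ∀ k, b ≤ φ (k + b) := fun k => (Nat.le_add_left b k).trans (hφ.id_le _)
    have hpow : ∀ k, 2 ^ φ (k + b) = 2 ^ b * 2 ^ (φ (k + b) - b) := fun k => by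
      rw [← pow_add, Nat.add_sub_cancel' (hle k)]
    refine ⟨fun k => 2 ^ (φ (k + b) - b), fun k => by positivity, ?_⟩
    filter_upwards [hsub] with ω hω ε hε
    filter_upwards [(tendsto_add_atTop_nat b).eventually (hω (ε / 2 ^ b) (by positivity))]
      with k hk x hx
    have hpow' : (2 : ℝ) ^ φ (k + b) = 2 ^ b * 2 ^ (φ (k + b) - b) := by exact_mod_cast hpow k
    have hpow'' : (2 : ℤ) ^ φ (k + b) = 2 ^ b * 2 ^ (φ (k + b) - b) := by exact_mod_cast hpow k
    refine (hk x fun i => (hx i).trans_lt ?_).trans (le_of_eq ?_)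
    · rw [hpow'']
      push_cast
      have : (B : ℤ) < 2 ^ b := by exact_mod_cast hb
      gcongr
    · rw [hpow']
      push_cast
      field_simp

end RWRE

/-! ### Mean zero of class `𝒦` under stationary measures -/

namespace MeasureTheory

/-- If `max f (-M)` has nonnegative integral for all `M`, then so does `f`. -/
theorem integrable_and_integral_nonneg_of_truncations {α : Type*} {mα : MeasurableSpace α}
    {μ : Measure α} [IsFiniteMeasure μ] {f : α → ℝ} (hf : AEStronglyMeasurable f μ)
    (hpos : Integrable (fun a => max (f a) 0) μ)
    (h : ∀ M : ℕ, 0 ≤ ∫ a, max (f a) (-M) ∂μ) : Integrable f μ ∧ 0 ≤ ∫ a, f a ∂μ := by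
  have hint : ∀ M : ℕ, Integrable (fun a => max (f a) (-M)) μ := by
    intro M
    refine (hpos.add (integrable_const (M : ℝ))).mono'
      (hf.sup aestronglyMeasurable_const) (Eventually.of_forall fun a => ?_)
    have hM : (0 : ℝ) ≤ M := Nat.cast_nonneg M
    simp only [Pi.add_apply, Real.norm_eq_abs]
    rw [abs_le]
    have h1 := le_max_right (f a) (-M : ℝ)
    have h2 := le_max_right (f a) 0
    have h3 := le_max_left (f a) 0
    exact ⟨by linarith, max_le (by linarith) (by linarith)⟩
  have htend : ∀ a, Tendsto (fun M : ℕ => max (f a) (-M)) atTop (𝓝 (f a)) := by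
    intro a
    refine tendsto_const_nhds.congr' ?_
    filter_upwards [(tendsto_natCast_atTop_atTop (R := ℝ)).eventually_ge_atTop (-f a)] with M hM
    rw [max_eq_left (by linarith)]
  -- Since |g| = 2 g⁺ - g and the truncation g has nonnegative integral, its L¹ norm is at most
  -- twice the integral of f⁺, uniformly in M. Fatou then gives integrability of f.
  have hle : ∀ M : ℕ, ∫ a, ‖max (f a) (-M)‖ ∂μ ≤ 2 * ∫ a, max (f a) 0 ∂μ := by
    intro M
    have hM : (0 : ℝ) ≤ M := Nat.cast_nonneg M
    have e : ∀ a, ‖max (f a) (-M)‖ = 2 * max (f a) 0 - max (f a) (-M) := by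
      intro a
      rcases le_total 0 (f a) with h0 | h0
      · rw [max_eq_left h0, max_eq_left (by linarith), Real.norm_of_nonneg h0]; ring
      · rw [max_eq_right h0, Real.norm_of_nonpos (max_le h0 (by linarith))]; ring
    simp only [e]
    rw [integral_sub (hpos.const_mul 2) (hint M), integral_const_mul]
    linarith [h M]
  have hfi : Integrable f μ := by
    refine ⟨hf, ?_⟩
    have h1 : ∫⁻ a, ‖f a‖ₑ ∂μ ≤ ENNReal.ofReal (2 * ∫ a, max (f a) 0 ∂μ) := by
      calc ∫⁻ a, ‖f a‖ₑ ∂μ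
          = ∫⁻ a, liminf (fun M : ℕ => ‖max (f a) (-M)‖ₑ) atTop ∂μ := by
            refine lintegral_congr fun a => ?_
            exact ((continuous_enorm.tendsto _).comp (htend a)).liminf_eq.symm
        _ ≤ liminf (fun M : ℕ => ∫⁻ a, ‖max (f a) (-M)‖ₑ ∂μ) atTop :=
            lintegral_liminf_le' fun M => (hint M).aestronglyMeasurable.enorm
        _ ≤ _ := by
            refine liminf_le_of_frequently_le' (Frequently.of_forall fun M => ?_)
            rw [← ofReal_integral_norm_eq_lintegral_enorm (hint M)]
            exact ENNReal.ofReal_le_ofReal (hle M)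
    exact h1.trans_lt ENNReal.ofReal_lt_top
  refine ⟨hfi, ge_of_tendsto' (tendsto_integral_of_dominated_convergence (fun a => ‖f a‖)
    (fun M => (hint M).aestronglyMeasurable) hfi.norm (fun M => Eventually.of_forall fun a => ?_)
    (Eventually.of_forall htend)) h⟩
  have hM : (0 : ℝ) ≤ M := Nat.cast_nonneg M
  simp only [Real.norm_eq_abs]
  rw [abs_le]
  have h1 := le_abs_self (f a)
  have h2 := neg_abs_le (f a)
  have h3 := le_max_left (f a) (-M : ℝ)
  exact ⟨by linarith, max_le h1 (by linarith [abs_nonneg (f a)])⟩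

end MeasureTheory

namespace RWRE

variable {d B : ℕ}

instance (μ : ProbabilityMeasure (Env d × steps d B)) : IsProbabilityMeasure (marginal₁ μ) :=
  Measure.isProbabilityMeasure_map measurable_fst.aemeasurable

instance (μ : ProbabilityMeasure (Env d × steps d B)) : IsProbabilityMeasure (marginal₂ μ) :=
  Measure.isProbabilityMeasure_map measurable_shift_step.aemeasurable

/-- Let W_n be the minimum of V over the box of radius B n, truncated at -M n. One step costs at
most max F (-M), so stationarity gives ∫ W_n ≤ n ∫ max F (-M) by induction on n. Dividing by n, the
left side tends to 0 along the good scales by sublinearity and bounded convergence. The truncation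
supplies integrability, since V itself need not be integrable under the marginal of ν. -/
theorem integral_truncation_nonneg_of_potential {P : Measure (Env d)}
    {F : Env d × steps d B → ℝ} (hFm : Measurable F) {V : (Fin d → ℤ) → Env d → ℝ}
    (hVm : ∀ x, Measurable (V x))
    (hV : ∀ᵐ ω ∂P, V 0 ω = 0 ∧
      ∀ (z : steps d B) x, V (z.1 + x) ω = F (ω, z) + V x (z.1 +ᵥ ω))
    {n : ℕ → ℕ} (hn : ∀ k, 0 < n k)
    (hsub : ∀ᵐ ω ∂P, ∀ ε > 0, ∀ᶠ k in atTop, ∀ x : Fin d → ℤ,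
      (∀ i, |x i| ≤ B * n k) → |V x ω| ≤ ε * n k)
    {ν : ProbabilityMeasure (Env d × steps d B)} (hst : marginal₁ ν = marginal₂ ν)
    (hac : marginal₁ ν ≪ P) (hpos : Integrable (fun p => max (F p) 0) (ν : Measure _)) (M : ℕ) :
    0 ≤ ∫ p, max (F p) (-M) ∂(ν : Measure (Env d × steps d B)) := by
  have hM : (0 : ℝ) ≤ M := Nat.cast_nonneg M
  set D : ℕ → Finset (Fin d → ℤ) := fun n =>
    Fintype.piFinset fun _ => Finset.Icc (-(B * n : ℤ)) (B * n) with hD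
  have hmem : ∀ n x, x ∈ D n ↔ ∀ i, |x i| ≤ B * n := fun n x => by
    simp only [hD, Fintype.mem_piFinset, mem_Icc, abs_le]
  have hD0 : ∀ n, (0 : Fin d → ℤ) ∈ D n := fun n => (hmem n 0).2 fun i => by
    simp only [Pi.zero_apply, abs_zero]; positivity
  set W : ℕ → Env d → ℝ := fun n ω =>
    max (-(M * n)) ((D n).inf' ⟨0, hD0 n⟩ fun x => V x ω) with hW
  have hWm : ∀ n, Measurable (W n) := by
    intro n
    refine measurable_const.max ?_
    have h1 : Measurable ((D n).inf' ⟨0, hD0 n⟩ V) := Finset.inf'_induction _ V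
      (p := fun f : Env d → ℝ => Measurable f) (fun _ h _ h' => h.inf h') fun x _ => hVm x
    convert h1 using 1
    ext ω
    exact (Finset.inf'_apply ⟨0, hD0 n⟩ V ω).symm
  have hWle : ∀ᵐ ω ∂P, ∀ n, W n ω ≤ 0 := by
    filter_upwards [hV] with ω hω n
    refine max_le (by simp only [neg_nonpos]; positivity) ((Finset.inf'_le _ (hD0 n)).trans ?_)
    rw [hω.1]
  have hge : ∀ n ω, -(M * n) ≤ W n ω := fun n ω => le_max_left _ _
  have hWabs : ∀ᵐ ω ∂P, ∀ n, ‖W n ω‖ ≤ M * n := by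
    filter_upwards [hWle] with ω hω n
    rw [Real.norm_of_nonpos (hω n)]
    linarith [hge n ω]
  have hWint : ∀ n, Integrable (W n) (marginal₁ ν) := fun n =>
    (integrable_const (M * n : ℝ)).mono' (hWm n).aestronglyMeasurable
      (Eventually.mono (hac.ae_le hWabs) fun ω hω => hω n)
  -- A step has coordinates at most B, so the box of radius B n around its endpoint lies in the box
  -- of radius B (n + 1) around the origin. The truncation level drops by M, which max F (-M)
  -- absorbs.
  have hstep : ∀ᵐ p ∂(ν : Measure (Env d × steps d B)), ∀ n,
      W (n + 1) p.1 ≤ max (F p) (-M) + W n (p.2.1 +ᵥ p.1) := by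
    filter_upwards [ae_of_ae_map measurable_fst.aemeasurable (hac.ae_le hV)] with p hp n
    refine max_le ?_ ?_
    · have h1 := le_max_right (F p) (-M : ℝ)
      have h2 := hge n (p.2.1 +ᵥ p.1)
      push_cast
      linarith
    · obtain ⟨x, hx, hxe⟩ := (D n).exists_mem_eq_inf' ⟨0, hD0 n⟩ fun x => V x (p.2.1 +ᵥ p.1)
      have h1 : p.2.1 + x ∈ D (n + 1) := (hmem _ _).2 fun i => by
        refine (abs_add_le _ _).trans ?_
        have h2 := abs_step_le p.2 i
        have h3 := (hmem n x).1 hx i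
        push_cast
        linarith
      refine (Finset.inf'_le _ h1).trans ?_
      rw [hp.2]
      have h2 := le_max_left (F p) (-M : ℝ)
      have h3 := le_max_right (-(M * n) : ℝ) ((D n).inf' ⟨0, hD0 n⟩ fun x => V x (p.2.1 +ᵥ p.1))
      rw [hxe] at h3
      simp only [hW]
      rw [hxe]
      exact add_le_add h2 h3
  have hFint : Integrable (fun p => max (F p) (-M)) (ν : Measure (Env d × steps d B)) := by
    refine (hpos.add (integrable_const (M : ℝ))).mono'
      (hFm.max measurable_const).aestronglyMeasurable (Eventually.of_forall fun a => ?_)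
    simp only [Pi.add_apply, Real.norm_eq_abs]
    rw [abs_le]
    have h1 := le_max_right (F a) (-M : ℝ)
    have h2 := le_max_right (F a) 0
    have h3 := le_max_left (F a) 0
    exact ⟨by linarith, max_le (by linarith) (by linarith)⟩
  have hind : ∀ n : ℕ, ∫ ω, W n ω ∂(marginal₁ ν) ≤
      n * ∫ p, max (F p) (-M) ∂(ν : Measure (Env d × steps d B)) := by
    intro n
    induction n with
    | zero =>
      simpa using integral_nonpos_of_ae (Eventually.mono (hac.ae_le hWle) fun ω hω => hω 0)
    | succ n ih =>
      have e1 : ∫ ω, W (n + 1) ω ∂(marginal₁ ν) =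
          ∫ p, W (n + 1) p.1 ∂(ν : Measure (Env d × steps d B)) :=
        integral_map measurable_fst.aemeasurable (hWm _).aestronglyMeasurable
      have e2 : ∫ ω, W n ω ∂(marginal₁ ν) =
          ∫ p, W n (p.2.1 +ᵥ p.1) ∂(ν : Measure (Env d × steps d B)) := by
        rw [hst]
        exact integral_map measurable_shift_step.aemeasurable (hWm _).aestronglyMeasurable
      have i1 : Integrable (fun p => W (n + 1) p.1) (ν : Measure (Env d × steps d B)) :=
        (hWint (n + 1)).comp_measurable measurable_fst
      have i2 : Integrable (fun p => W n (p.2.1 +ᵥ p.1)) (ν : Measure (Env d × steps d B)) := by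
        have h1 := hWint n
        rw [hst] at h1
        exact h1.comp_measurable measurable_shift_step
      have h1 := integral_mono_ae i1 (hFint.add i2) (hstep.mono fun p hp => hp n)
      simp only [Pi.add_apply] at h1
      rw [integral_add hFint i2, ← e1, ← e2] at h1
      push_cast
      linarith
  have hlim : Tendsto (fun k => ∫ ω, (n k : ℝ)⁻¹ * W (n k) ω ∂(marginal₁ ν)) atTop (𝓝 0) := by
    rw [← integral_zero (Env d) ℝ (μ := marginal₁ ν)]
    refine tendsto_integral_of_dominated_convergence (fun _ => (M : ℝ))
      (fun k => ((hWm _).const_mul _).aestronglyMeasurable) (integrable_const _) (fun k => ?_) ?_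
    · filter_upwards [hac.ae_le hWabs] with ω hω
      have h0 : (0 : ℝ) < n k := by exact_mod_cast hn k
      rw [norm_mul, Real.norm_of_nonneg (by positivity), inv_mul_le_iff₀ h0, mul_comm]
      exact hω _
    · filter_upwards [hac.ae_le hWle, hac.ae_le hsub] with ω h1 h2
      rw [Metric.tendsto_nhds]
      intro ε hε
      filter_upwards [h2 (ε / 2) (by positivity)] with k hk
      have h0 : (0 : ℝ) < n k := by exact_mod_cast hn k
      rw [dist_zero_right, norm_mul, Real.norm_of_nonneg (by positivity), inv_mul_lt_iff₀ h0,
        Real.norm_of_nonpos (h1 _)]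
      obtain ⟨x, hx, hxe⟩ := (D (n k)).exists_mem_eq_inf' ⟨0, hD0 _⟩ fun x => V x ω
      have h3 : V x ω ≤ W (n k) ω := by
        rw [← hxe]
        exact le_max_right _ _
      have h4 := (abs_le.1 (hk x ((hmem _ _).1 hx))).1
      nlinarith
  refine ge_of_tendsto' (a := ∫ p, max (F p) (-M) ∂(ν : Measure (Env d × steps d B)))
    (f := fun k => ∫ p, max (F p) (-M) ∂(ν : Measure (Env d × steps d B)) -
      ∫ ω, (n k : ℝ)⁻¹ * W (n k) ω ∂(marginal₁ ν)) (x := atTop) ?_ fun k => ?_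
  · simpa using tendsto_const_nhds.sub hlim
  · have h0 : (0 : ℝ) < n k := by exact_mod_cast hn k
    have h1 := hind (n k)
    rw [integral_const_mul, sub_nonneg, inv_mul_le_iff₀ h0]
    exact h1

/-- A function of class `𝒦` with integrable positive part is integrable with mean zero under all
measures with equal marginals that are absolutely continuous with respect to `P`. -/
theorem ClassK.integrable_and_integral_eq_zero (hd : 1 ≤ d) {P : Measure (Env d)}
    [IsProbabilityMeasure P] [ErgodicVAdd (Fin d → ℤ) (Env d) P] {F : Env d × steps d B → ℝ}
    (hF : ClassK P F) {ν : ProbabilityMeasure (Env d × steps d B)}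
    (hst : marginal₁ ν = marginal₂ ν) (hac : marginal₁ ν ≪ P)
    (hpos : Integrable (fun p => max (F p) 0) (ν : Measure _)) :
    Integrable F (ν : Measure _) ∧ ∫ p, F p ∂(ν : Measure (Env d × steps d B)) = 0 := by
  have hne : Nonempty (steps d B) := by
    obtain ⟨p⟩ := nonempty_of_isProbabilityMeasure (ν : Measure (Env d × steps d B))
    exact ⟨p.2⟩
  obtain ⟨V, hVm, hV, n, hn, hsub⟩ := hF.exists_potential hd
  have h1 := integrable_and_integral_nonneg_of_truncations hF.measurable.aestronglyMeasurable hpos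
    (integral_truncation_nonneg_of_potential hF.measurable hVm hV hn hsub hst hac hpos)
  have hneg : Integrable (fun p => max (-F p) 0) (ν : Measure (Env d × steps d B)) := h1.1.neg_part
  have h2 := integrable_and_integral_nonneg_of_truncations
    hF.measurable.neg.aestronglyMeasurable hneg
    (integral_truncation_nonneg_of_potential hF.measurable.neg (V := fun x ω => -V x ω)
      (fun x => (hVm x).neg) (hV.mono fun ω hω => ⟨by rw [hω.1, neg_zero], fun z x => by
        rw [hω.2, neg_add]; rfl⟩) hn (by simpa only [abs_neg] using hsub) hst hac hneg)
  refine ⟨h1.1, le_antisymm ?_ h1.2⟩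
  have h3 := h2.2
  rw [integral_neg'] at h3
  linarith

end RWRE

/-! ### Relative entropy and exponential tilting -/

namespace MeasureTheory

section Tilted

variable {α : Type*} {mα : MeasurableSpace α} {ν ρ : Measure α} [IsProbabilityMeasure ν]
  [IsProbabilityMeasure ρ] {f : α → ℝ}

/-- With ρ' the tilted measure, f = log(dν/dρ) - log(dν/dρ'). The first term is integrable, and x ≤
e^x bounds the second by dρ'/dν, whose integral under ν is finite. Only this one-sided control is
available before F is known to be integrable. -/
theorem integrable_pos_part_of_integrable_llr (hf : Measurable f)
    (hexp : Integrable (fun a => Real.exp (f a)) ρ) (h1 : ∫ a, Real.exp (f a) ∂ρ = 1)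
    (hac : ν ≪ ρ) (hint : Integrable (llr ν ρ) ν) : Integrable (fun a => max (f a) 0) ν := by
  have : IsProbabilityMeasure (ρ.tilted f) := isProbabilityMeasure_tilted hexp
  have hac' : ν ≪ ρ.tilted f := hac.trans (absolutelyContinuous_tilted hexp)
  have h2 : Integrable (fun a => Real.exp (-llr ν (ρ.tilted f) a)) ν :=
    (integrable_congr (exp_neg_llr hac')).2 Measure.integrable_toReal_rnDeriv
  refine (h2.add hint.abs).mono' (hf.max measurable_const).aestronglyMeasurable ?_
  filter_upwards [llr_tilted_right hac hexp] with a ha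
  rw [h1, Real.log_one, add_zero] at ha
  rw [Real.norm_of_nonneg (le_max_right _ _)]
  simp only [Pi.add_apply]
  have h3 := Real.add_one_le_exp (-llr ν (ρ.tilted f) a)
  have h4 := le_abs_self (llr ν ρ a)
  exact max_le (by linarith) (by positivity)

theorem integral_llr_eq_add_of_tilted
    (hexp : Integrable (fun a => Real.exp (f a)) ρ) (h1 : ∫ a, Real.exp (f a) ∂ρ = 1)
    (hac : ν ≪ ρ) (hint : Integrable (llr ν ρ) ν) (hfi : Integrable f ν) :
    ∫ a, llr ν ρ a ∂ν =
      (InformationTheory.klDiv ν (ρ.tilted f)).toReal + ∫ a, f a ∂ν := by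
  have : IsProbabilityMeasure (ρ.tilted f) := isProbabilityMeasure_tilted hexp
  rw [InformationTheory.toReal_klDiv_of_measure_eq
    (hac.trans (absolutelyContinuous_tilted hexp)) (by simp),
    integral_llr_tilted_right hac hfi hexp hint, h1, Real.log_one]
  ring

theorem klDiv_eq_ofReal_integral_llr (hac : ν ≪ ρ) (hint : Integrable (llr ν ρ) ν) :
    InformationTheory.klDiv ν ρ = ENNReal.ofReal (∫ a, llr ν ρ a ∂ν) := by
  rw [InformationTheory.klDiv_of_ac_of_integrable hac hint]
  simp

/-- The Gibbs variational inequality for an exponentially tilted measure. -/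
theorem ofReal_integral_le_klDiv_of_tilted
    (hexp : Integrable (fun a => Real.exp (f a)) ρ) (h1 : ∫ a, Real.exp (f a) ∂ρ = 1)
    (hac : ν ≪ ρ) (hint : Integrable (llr ν ρ) ν) (hfi : Integrable f ν) :
    ENNReal.ofReal (∫ a, f a ∂ν) ≤ InformationTheory.klDiv ν ρ := by
  rw [klDiv_eq_ofReal_integral_llr hac hint, integral_llr_eq_add_of_tilted hexp h1 hac hint hfi]
  exact ENNReal.ofReal_le_ofReal (le_add_of_nonneg_left ENNReal.toReal_nonneg)

/-- Equality in the Gibbs inequality forces the entropy relative to the tilted measure to vanish.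
Nonnegativity of the integral keeps `ENNReal.ofReal` from losing information. -/
theorem eq_tilted_of_klDiv_eq
    (hexp : Integrable (fun a => Real.exp (f a)) ρ) (h1 : ∫ a, Real.exp (f a) ∂ρ = 1)
    (hac : ν ≪ ρ) (hint : Integrable (llr ν ρ) ν) (hfi : Integrable f ν)
    (h0 : 0 ≤ ∫ a, f a ∂ν)
    (h : InformationTheory.klDiv ν ρ = ENNReal.ofReal (∫ a, f a ∂ν)) : ν = ρ.tilted f := by
  have : IsProbabilityMeasure (ρ.tilted f) := isProbabilityMeasure_tilted hexp
  have hac' : ν ≪ ρ.tilted f := hac.trans (absolutelyContinuous_tilted hexp)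
  have h2 := integral_llr_eq_add_of_tilted hexp h1 hac hint hfi
  rw [klDiv_eq_ofReal_integral_llr hac hint, h2, ENNReal.ofReal_eq_ofReal_iff
    (add_nonneg ENNReal.toReal_nonneg h0) h0, add_eq_right,
    ENNReal.toReal_eq_zero_iff] at h
  refine InformationTheory.klDiv_eq_zero_iff.1 (h.resolve_right ?_)
  exact InformationTheory.klDiv_ne_top hac' (integrable_llr_tilted_right hac hfi hint hexp)

/-- The density e^f cancels e^(-f), so e^(-f) is integrable under the tilted measure and dominates
the negative part. This serves the candidate minimizer, whose entropy is not yet known to be finite.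
-/
theorem integrable_neg_part_tilted (hf : Measurable f)
    (hexp : Integrable (fun a => Real.exp (f a)) ρ) :
    Integrable (fun a => max (-f a) 0) (ρ.tilted f) := by
  have h1 : Integrable (fun a => Real.exp (-f a)) (ρ.tilted f) := by
    rw [integrable_tilted_iff hexp]
    simp only [smul_eq_mul, ← Real.exp_add, add_neg_cancel, Real.exp_zero]
    exact integrable_const _
  refine h1.mono' (hf.neg.max measurable_const).aestronglyMeasurable
    (Eventually.of_forall fun a => ?_)
  rw [Real.norm_of_nonneg (le_max_right _ _)]
  exact max_le (by linarith [Real.add_one_le_exp (-f a)]) (by positivity)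

theorem llr_tilted_self (hexp : Integrable (fun a => Real.exp (f a)) ρ)
    (h1 : ∫ a, Real.exp (f a) ∂ρ = 1) : llr (ρ.tilted f) ρ =ᵐ[ρ.tilted f] f := by
  filter_upwards [(tilted_absolutelyContinuous ρ f).ae_le
    (log_rnDeriv_tilted_left_self hexp)] with a ha
  rw [llr, ha, h1, Real.log_one, sub_zero]

theorem klDiv_tilted_self (hexp : Integrable (fun a => Real.exp (f a)) ρ)
    (h1 : ∫ a, Real.exp (f a) ∂ρ = 1) (hfi : Integrable f (ρ.tilted f)) :
    0 ≤ ∫ a, f a ∂(ρ.tilted f) ∧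
      InformationTheory.klDiv (ρ.tilted f) ρ = ENNReal.ofReal (∫ a, f a ∂(ρ.tilted f)) := by
  have : IsProbabilityMeasure (ρ.tilted f) := isProbabilityMeasure_tilted hexp
  have h2 := llr_tilted_self hexp h1
  have hint : Integrable (llr (ρ.tilted f) ρ) (ρ.tilted f) := (integrable_congr h2).2 hfi
  have hac := tilted_absolutelyContinuous ρ f
  rw [← integral_congr_ae h2]
  refine ⟨?_, klDiv_eq_ofReal_integral_llr hac hint⟩
  simpa using InformationTheory.integral_llr_add_sub_measure_univ_nonneg hac hint

end Tilted

end MeasureTheory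

/-! ### Measures with a prescribed environment kernel -/

namespace RWRE

variable {d B : ℕ}

theorem stepProb_nonneg (ω : Env d) (x z : Fin d → ℤ) : 0 ≤ stepProb ω x z := (ω x).2.1 z

theorem measurable_stepProb : Measurable fun p : Env d × steps d B => stepProb p.1 0 p.2 := by
  refine measurable_from_prod_countable_left fun z => Continuous.measurable ?_
  have h1 : Continuous fun q : StepLaw d => q.1 z.1 :=
    (continuous_apply z.1).comp continuous_subtype_val
  exact h1.comp (continuous_apply (0 : Fin d → ℤ))

theorem measurable_stepVec :
    Measurable fun p : Env d × steps d B => stepVec p.2 :=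
  (measurable_of_countable (stepVec (d := d) (B := B))).comp measurable_snd

theorem integrable_stepVec (ν : ProbabilityMeasure (Env d × steps d B)) :
    Integrable (fun p => stepVec p.2) (ν : Measure (Env d × steps d B)) := by
  obtain ⟨C, hC⟩ := (Set.finite_range fun z : steps d B => ‖stepVec z‖).bddAbove
  exact (integrable_const C).mono' measurable_stepVec.aestronglyMeasurable
    (Eventually.of_forall fun p => hC ⟨p.2, rfl⟩)

theorem lintegral_semiProd (Q : Measure (Env d)) [SFinite Q] {g : Env d × steps d B → ℝ}
    (hg : Measurable g) {h : Env d × steps d B → ℝ≥0∞} (hh : Measurable h) :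
    ∫⁻ p, h p ∂(semiProd Q g) = ∫⁻ ω, ∑' z, ENNReal.ofReal (g (ω, z)) * h (ω, z) ∂Q := by
  rw [semiProd, lintegral_withDensity_eq_lintegral_mul _ hg.ennreal_ofReal hh,
    lintegral_prod _ (hg.ennreal_ofReal.mul hh).aemeasurable]
  simp only [Pi.mul_apply, lintegral_count]

theorem tsum_stepProb_eq_one {P : Measure (Env d)}
    (hB : ∀ z : Fin d → ℤ, z ∉ steps d B → ∀ᵐ ω ∂P, stepProb ω 0 z = 0) :
    ∀ᵐ ω ∂P, ∑' z : steps d B, ENNReal.ofReal (stepProb ω 0 z) = 1 := by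
  have h : ∀ᵐ ω ∂P, ∀ z : Fin d → ℤ, z ∉ steps d B → stepProb ω 0 z = 0 :=
    ae_all_iff.2 fun z => by
      by_cases hz : z ∈ steps d B
      · simp [hz]
      · filter_upwards [hB z hz] with ω hω _ using hω
  filter_upwards [h] with ω hω
  have h1 : HasSum (fun z => stepProb ω 0 z) 1 := (ω 0).2.2
  have h2 : HasSum (fun z : steps d B => stepProb ω 0 z) 1 :=
    (hasSum_subtype_iff_of_support_subset fun z hz => by
      by_contra h
      exact hz (hω z h)).2 h1
  rw [← ENNReal.ofReal_tsum_of_nonneg (fun z : steps d B => stepProb_nonneg ω 0 z) h2.summable, h2.tsum_eq,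
    ENNReal.ofReal_one]

theorem isProbabilityMeasure_semiProd_stepProb {P : Measure (Env d)}
    (hB : ∀ z : Fin d → ℤ, z ∉ steps d B → ∀ᵐ ω ∂P, stepProb ω 0 z = 0)
    {Q : Measure (Env d)} [IsProbabilityMeasure Q] (hQ : Q ≪ P) :
    IsProbabilityMeasure (semiProd (B := B) Q fun p => stepProb p.1 0 p.2) := by
  refine ⟨?_⟩
  rw [← lintegral_one, lintegral_semiProd Q measurable_stepProb measurable_const]
  simp only [mul_one]
  rw [lintegral_congr_ae (hQ.ae_le (tsum_stepProb_eq_one hB))]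
  simp

theorem semiProd_mul_exp (Q : Measure (Env d)) {f : Env d × steps d B → ℝ} (hf : Measurable f) :
    semiProd Q (fun p => stepProb p.1 0 p.2 * Real.exp (f p)) =
      (semiProd Q fun p => stepProb p.1 0 p.2).withDensity
        fun p => ENNReal.ofReal (Real.exp (f p)) := by
  rw [semiProd, semiProd, ← withDensity_mul _ measurable_stepProb.ennreal_ofReal
    hf.exp.ennreal_ofReal]
  congr 1
  ext1 p
  rw [Pi.mul_apply, ENNReal.ofReal_mul (stepProb_nonneg _ _ _)]

/-- If `μ` disintegrates over its first marginal with density `g`, then `g` is almost surely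
normalized. -/
theorem tsum_eq_one_of_eq_semiProd {μ : ProbabilityMeasure (Env d × steps d B)}
    {g : Env d × steps d B → ℝ} (hg : Measurable g)
    (hμ : (μ : Measure (Env d × steps d B)) = semiProd (marginal₁ μ) g) :
    ∀ᵐ ω ∂(marginal₁ μ), ∑' z, ENNReal.ofReal (g (ω, z)) = 1 := by
  have hm : Measurable fun ω => ∑' z, ENNReal.ofReal (g (ω, z)) :=
    Measurable.tsum fun z =>
      (hg.comp (measurable_id.prodMk measurable_const)).ennreal_ofReal
  refine ae_eq_of_forall_setLIntegral_eq_of_sigmaFinite hm measurable_const fun s hs _ => ?_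
  rw [setLIntegral_const, one_mul]
  have h1 : marginal₁ μ s = (μ : Measure (Env d × steps d B)) (Prod.fst ⁻¹' s) :=
    Measure.map_apply measurable_fst hs
  have hind : Measurable ((Prod.fst ⁻¹' s).indicator (1 : Env d × steps d B → ℝ≥0∞)) :=
    measurable_one.indicator (measurable_fst hs)
  rw [h1, ← lintegral_indicator_one (measurable_fst hs), ← lintegral_indicator hs]
  conv_rhs => rw [hμ]
  rw [lintegral_semiProd _ hg hind]
  refine lintegral_congr fun ω => ?_
  by_cases hω : ω ∈ s <;> simp [hω]

/-! ### Consequences of ergodicity and positivity on unit steps -/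

variable {P : Measure (Env d)}

/-- A set that is almost surely mapped into itself by all unit shifts is null or conull. -/
theorem ae_notMem_or_ae_mem_of_unitStep [Nonempty (steps d B)] [IsProbabilityMeasure P]
    [ErgodicVAdd (Fin d → ℤ) (Env d) P] {A : Set (Env d)} (hA : MeasurableSet A)
    (h : ∀ z : steps d B, IsUnitStep z → ∀ᵐ ω ∂P, ω ∈ A → z.1 +ᵥ ω ∈ A) :
    (∀ᵐ ω ∂P, ω ∈ A) ∨ ∀ᵐ ω ∂P, ω ∉ A := by
  let S : AddSubmonoid (Fin d → ℤ) :=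
    { carrier := {x | (x +ᵥ ·) ⁻¹' A =ᵐ[P] A}
      zero_mem' := by
        simp only [Set.mem_ofPred_eq, zero_vadd]
        rfl
      add_mem' := by
        intro x y hx hy
        have h1 := (measurePreserving_vadd y P).quasiMeasurePreserving.preimage_ae_eq hx
        simp only [Set.mem_ofPred_eq, add_vadd]
        exact h1.trans hy }
  have hS : S = ⊤ := addSubmonoid_eq_top_of_single_mem fun i c hc => by
    obtain ⟨z, hz, hzi⟩ := exists_isUnitStep_eq_single (B := B) i hc
    have h1 : A ≤ᵐ[P] (z.1 +ᵥ ·) ⁻¹' A := h z hz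
    -- The shift preserves P, so the inclusion of A in its preimage is an equality up to a null set.
    have h2 := ae_eq_of_ae_subset_of_measure_ge h1
      ((measurePreserving_vadd z.1 P).measure_preimage hA.nullMeasurableSet).le
      hA.nullMeasurableSet (measure_ne_top P _)
    rw [← hzi]
    exact h2.symm
  have hx : ∀ x, x ∈ S := (AddSubmonoid.eq_top_iff' S).1 hS
  exact eventuallyConst_set.1 (aeconst_of_forall_preimage_vadd_ae_eq (Fin d → ℤ)
    hA.nullMeasurableSet hx)

/-- A property that holds almost surely under a measure with positive environment kernel on unit
steps holds for almost all environments and all unit steps. -/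
theorem ae_unitStep_of_ae {μ : ProbabilityMeasure (Env d × steps d B)}
    (hμ : μ ∈ stationaryMeasures B P) {p : Env d × steps d B → Prop}
    (hp : ∀ᵐ q ∂(μ : Measure (Env d × steps d B)), p q) (z : steps d B) (hz : IsUnitStep z) :
    ∀ᵐ ω ∂(marginal₁ μ), p (ω, z) := by
  -- The absolutely continuous part of μ is dominated by μ, and its density is positive on unit
  -- steps.
  have h1 : ∀ᵐ q ∂((marginal₁ μ).prod Measure.count).withDensity (envKernel μ), p q :=
    (Measure.absolutelyContinuous_of_le (Measure.withDensity_rnDeriv_le _ _)).ae_le hp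
  have hm : Measurable (envKernel μ) := Measure.measurable_rnDeriv _ _
  rw [ae_withDensity_iff hm] at h1
  filter_upwards [Measure.ae_ae_of_ae_prod h1, hμ.2.1.ae_le (hμ.2.2 z hz)] with ω h2 h3
  exact Measure.ae_count_iff.1 h2 z h3.ne'

variable [IsProbabilityMeasure P] [ErgodicVAdd (Fin d → ℤ) (Env d) P]

theorem nonempty_steps (μ : ProbabilityMeasure (Env d × steps d B)) : Nonempty (steps d B) :=
  (nonempty_of_isProbabilityMeasure (μ : Measure (Env d × steps d B))).map Prod.snd

/-- Let A be the set where d(μ)¹/dP is nonzero. By stationarity the shifted environment is also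
μ-a.s. in A, so positivity on U makes A closed under unit shifts. A null A would contradict total
mass one, so A is conull. -/
theorem absolutelyContinuous_marginal₁ {μ : ProbabilityMeasure (Env d × steps d B)}
    (hμ : μ ∈ stationaryMeasures B P) : P ≪ marginal₁ μ := by
  have := nonempty_steps μ
  have hm : Measurable ((marginal₁ μ).rnDeriv P) := Measure.measurable_rnDeriv _ _
  set A : Set (Env d) := {ω | (marginal₁ μ).rnDeriv P ω ≠ 0} with hA
  have hAm : MeasurableSet A := hm (measurableSet_singleton 0).compl
  have hwd : P.withDensity ((marginal₁ μ).rnDeriv P) = marginal₁ μ :=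
    Measure.withDensity_rnDeriv_eq _ _ hμ.2.1
  have hiff : ∀ q : Env d → Prop, (∀ᵐ ω ∂(marginal₁ μ), q ω) ↔ ∀ᵐ ω ∂P, ω ∈ A → q ω := by
    intro q
    conv_lhs => rw [← hwd]
    exact ae_withDensity_iff hm
  have h1 : ∀ᵐ ω ∂(marginal₁ μ), ω ∈ A := (hiff _).2 (Eventually.of_forall fun _ h => h)
  have h2 : ∀ᵐ p ∂(μ : Measure (Env d × steps d B)), p.2.1 +ᵥ p.1 ∈ A := by
    refine ae_of_ae_map measurable_shift_step.aemeasurable (p := fun ω => ω ∈ A) ?_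
    have h3 := h1
    rw [hμ.1] at h3
    exact h3
  rcases ae_notMem_or_ae_mem_of_unitStep (B := B) hAm
    fun z hz => (hiff _).1 (ae_unitStep_of_ae hμ h2 z hz) with h3 | h3
  · conv_rhs => rw [← hwd]
    exact withDensity_absolutelyContinuous' hm.aemeasurable h3
  · exfalso
    have h4 : ∀ᵐ ω ∂(marginal₁ μ), False := by
      filter_upwards [h1, hμ.2.1.ae_le h3] with ω h5 h6 using h6 h5
    simp [IsProbabilityMeasure.ne_zero] at h4

/-- A stationary measure is determined by its environment kernel. -/
theorem eq_of_eq_semiProd {μ ν : ProbabilityMeasure (Env d × steps d B)}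
    {g : Env d × steps d B → ℝ} (hg : Measurable g)
    (hμ : μ ∈ stationaryMeasures B P) (hν : ν ∈ stationaryMeasures B P)
    (hμg : (μ : Measure (Env d × steps d B)) = semiProd (marginal₁ μ) g)
    (hνg : (ν : Measure (Env d × steps d B)) = semiProd (marginal₁ ν) g) : ν = μ := by
  have := nonempty_steps μ
  have hPμ := absolutelyContinuous_marginal₁ hμ
  have hνμ : marginal₁ ν ≪ marginal₁ μ := hν.2.1.trans hPμ
  set φ := (marginal₁ ν).rnDeriv (marginal₁ μ) with hφ
  have hφm : Measurable φ := Measure.measurable_rnDeriv _ _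
  have hwd : (marginal₁ μ).withDensity φ = marginal₁ ν := Measure.withDensity_rnDeriv_eq _ _ hνμ
  have hνμ' : (ν : Measure (Env d × steps d B)) =
      (μ : Measure (Env d × steps d B)).withDensity fun p => φ p.1 := by
    rw [hνg, ← hwd]
    conv_rhs => rw [hμg]
    have hφm' : Measurable fun p : Env d × steps d B => φ p.1 := hφm.comp measurable_fst
    rw [semiProd, semiProd, prod_withDensity_left hφm, ← withDensity_mul _ hφm'
      hg.ennreal_ofReal, ← withDensity_mul _ hg.ennreal_ofReal hφm', mul_comm]
  have hone : φ =ᵐ[marginal₁ μ] 1 → ν = μ := by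
    intro h
    have h1 : marginal₁ ν = marginal₁ μ := by
      rw [← hwd, withDensity_congr_ae h, withDensity_one]
    refine Subtype.ext ?_
    change (ν : Measure (Env d × steps d B)) = μ
    rw [hνg, h1, ← hμg]
  have hint : ∫⁻ ω, φ ω ∂(marginal₁ μ) = 1 := by
    rw [← setLIntegral_univ, ← withDensity_apply _ MeasurableSet.univ, hwd, measure_univ]
  set A : Set (Env d) := {ω | 1 < φ ω} with hA
  have hAm : MeasurableSet A := measurableSet_lt measurable_const hφm
  set S : Set (Env d × steps d B) := Prod.fst ⁻¹' A with hS
  set S' : Set (Env d × steps d B) := (fun p => p.2.1 +ᵥ p.1) ⁻¹' A with hS'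
  have hSm : MeasurableSet S := measurable_fst hAm
  have hSm' : MeasurableSet S' := measurable_shift_step hAm
  have hmeas : ∀ η : ProbabilityMeasure (Env d × steps d B), η ∈ stationaryMeasures B P →
      (η : Measure (Env d × steps d B)) S' = (η : Measure (Env d × steps d B)) S := by
    intro η hη
    have h1 : marginal₁ η A = (η : Measure (Env d × steps d B)) S :=
      Measure.map_apply measurable_fst hAm
    have h2 : marginal₂ η A = (η : Measure (Env d × steps d B)) S' :=
      Measure.map_apply measurable_shift_step hAm
    rw [← h1, ← h2, hη.1]
  have hφS : ∀ T : Set (Env d × steps d B), MeasurableSet T →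
      ∫⁻ p, T.indicator (fun p => φ p.1) p ∂(μ : Measure (Env d × steps d B)) =
        (ν : Measure (Env d × steps d B)) T := by
    intro T hT
    rw [lintegral_indicator hT, hνμ', withDensity_apply _ hT]
  have hi : ∀ T : Set (Env d × steps d B), MeasurableSet T →
      Measurable (T.indicator fun p : Env d × steps d B => φ p.1) := fun T hT =>
    (hφm.comp measurable_fst).indicator hT
  have hi' : ∀ T : Set (Env d × steps d B), MeasurableSet T →
      Measurable (T.indicator (1 : Env d × steps d B → ℝ≥0∞)) := fun T hT =>
    measurable_one.indicator hT
  have hfin : ∀ᵐ p ∂(μ : Measure (Env d × steps d B)), φ p.1 < ∞ :=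
    ae_of_ae_map measurable_fst.aemeasurable (Measure.rnDeriv_lt_top _ _)
  -- Stationarity of μ and ν gives ∫ (φ - 1)(1_S - 1_S') dμ = 0, and the integrand is nonnegative
  -- because S is where φ > 1. It therefore vanishes a.e., so S is contained in S' up to a null set.
  -- The terms are rearranged to avoid subtraction in `ℝ≥0∞`.
  have heq := ae_eq_of_ae_le_of_lintegral_le (μ := (μ : Measure (Env d × steps d B)))
    (f := fun p => S'.indicator (fun p => φ p.1) p + S.indicator 1 p)
    (g := fun p => S.indicator (fun p => φ p.1) p + S'.indicator 1 p)
    (Eventually.of_forall fun p => by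
      by_cases h1 : p ∈ S <;> by_cases h2 : p ∈ S' <;> simp only [h1, h2, Set.indicator_of_mem,
        Set.indicator_of_notMem, not_false_eq_true, Pi.one_apply, zero_add, add_zero, le_refl]
      · exact (show 1 < φ p.1 from h1).le
      · exact not_lt.1 h1)
    (by
      rw [lintegral_add_left (hi S' hSm'), hφS _ hSm', lintegral_indicator_one hSm]
      exact ENNReal.add_ne_top.2 ⟨measure_ne_top _ _, measure_ne_top _ _⟩)
    ((hi S hSm).add (hi' S' hSm')).aemeasurable
    (by
      rw [lintegral_add_left (hi S' hSm'), hφS _ hSm', lintegral_indicator_one hSm,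
        lintegral_add_left (hi S hSm), hφS _ hSm, lintegral_indicator_one hSm', hmeas μ hμ,
        hmeas ν hν])
  have hSS' : ∀ᵐ p ∂(μ : Measure (Env d × steps d B)), p ∈ S → p ∈ S' := by
    filter_upwards [heq] with p hp h1
    by_contra h2
    simp only [h1, h2, Set.indicator_of_mem, Set.indicator_of_notMem, not_false_eq_true,
      Pi.one_apply, zero_add, add_zero] at hp
    exact (show 1 < φ p.1 from h1).ne hp
  -- Now A is null or conull, so φ ≤ 1 or φ ≥ 1 a.e.; having integral 1, it equals 1.
  refine hone ?_
  rcases ae_notMem_or_ae_mem_of_unitStep (B := B) hAm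
    fun z hz => hPμ.ae_le (ae_unitStep_of_ae hμ hSS' z hz) with h | h
  · refine (ae_eq_of_ae_le_of_lintegral_le ?_ (by simp) hφm.aemeasurable (by simp [hint])).symm
    filter_upwards [hμ.2.1.ae_le h] with ω hω using (show 1 < φ ω from hω).le
  · refine ae_eq_of_ae_le_of_lintegral_le ?_ (by simp [hint]) aemeasurable_one (by simp [hint])
    filter_upwards [hμ.2.1.ae_le h] with ω hω using not_lt.1 hω

/-! ### The minimum value and its unique minimizer -/

/-- Under a stationary measure with mean velocity `ξ`, the log-density `⟨θ, z⟩ + F + r` has mean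
`⟨θ, ξ⟩ + r`, as soon as its positive part is integrable. -/
theorem ClassK.integrable_and_integral_eq (hd : 1 ≤ d) {F : Env d × steps d B → ℝ}
    (hF : ClassK P F) {ν : ProbabilityMeasure (Env d × steps d B)}
    (hν : ν ∈ stationaryMeasures B P) (θ : EuclideanSpace ℝ (Fin d)) (r : ℝ)
    (hpos : Integrable (fun p => max (inner ℝ θ (stepVec p.2) + F p + r) 0) (ν : Measure _)) :
    Integrable (fun p => inner ℝ θ (stepVec p.2) + F p + r) (ν : Measure _) ∧
      ∫ p, (inner ℝ θ (stepVec p.2) + F p + r) ∂(ν : Measure (Env d × steps d B)) =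
        inner ℝ θ (meanVelocity ν) + r := by
  have h1 : Integrable (fun p => inner ℝ θ (stepVec p.2)) (ν : Measure (Env d × steps d B)) :=
    (integrable_stepVec ν).const_inner θ
  have h2 : Integrable (fun p => max (F p) 0) (ν : Measure (Env d × steps d B)) := by
    refine (hpos.add (h1.abs.add (integrable_const |r|))).mono'
      (hF.measurable.max measurable_const).aestronglyMeasurable (Eventually.of_forall fun p => ?_)
    rw [Real.norm_of_nonneg (le_max_right _ _)]
    simp only [Pi.add_apply]
    have h3 := le_max_left (inner ℝ θ (stepVec p.2) + F p + r) 0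
    have h4 := le_max_right (inner ℝ θ (stepVec p.2) + F p + r) 0
    have h5 := neg_abs_le (inner ℝ θ (stepVec p.2))
    have h6 := neg_abs_le r
    exact max_le (by linarith) (by positivity)
  obtain ⟨h3, h4⟩ := hF.integrable_and_integral_eq_zero hd hν.1 hν.2.1 h2
  refine ⟨(h1.add h3).add (integrable_const r), ?_⟩
  have h5 : Integrable (fun p => inner ℝ θ (stepVec p.2) + F p)
    (ν : Measure (Env d × steps d B)) := h1.add h3
  rw [integral_add h5 (integrable_const r), integral_add h1 h3, h4,
    integral_inner (integrable_stepVec ν)]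
  simp [meanVelocity]

theorem ClassK.neg {P : Measure (Env d)} {F : Env d × steps d B → ℝ} (hF : ClassK P F) :
    ClassK P (-F) where
  measurable := hF.measurable.neg
  moment z := (hF.moment z).imp fun _ h => ⟨h.1, h.2.neg⟩
  mean_zero z := by
    simp only [Pi.neg_apply]
    rw [integral_neg, hF.mean_zero, neg_zero]
  closed_loop := hF.closed_loop.mono fun ω hω n x s hs hx => by
    simp only [Pi.neg_apply]
    rw [sum_neg_distrib, hω n x s hs hx, neg_zero]

theorem pairRate_eq_velocityRate_and_unique {d : ℕ} (hd : 1 ≤ d) {B : ℕ}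
    {P : Measure (Env d)} [IsProbabilityMeasure P] [ErgodicVAdd (Fin d → ℤ) (Env d) P]
    (hB : ∀ z : Fin d → ℤ, z ∉ steps d B → ∀ᵐ ω ∂P, stepProb ω 0 z = 0)
    {ξ : EuclideanSpace ℝ (Fin d)} {μξ : ProbabilityMeasure (Env d × steps d B)}
    (hA : μξ ∈ velocitySet B ξ) (hM : μξ ∈ stationaryMeasures B P)
    {θ : EuclideanSpace ℝ (Fin d)} {F : Env d × steps d B → ℝ} (hF : ClassK P F) {r : ℝ}
    (hform : (μξ : Measure (Env d × steps d B)) = semiProd (marginal₁ μξ) fun p =>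
      stepProb p.1 0 p.2 * Real.exp (inner ℝ θ (stepVec p.2) + F p + r)) :
    pairRate P μξ = velocityRate B P ξ ∧
      ∀ ν ∈ velocitySet B ξ, pairRate P ν = velocityRate B P ξ → ν = μξ := by
  set f : Env d × steps d B → ℝ := fun p => inner ℝ θ (stepVec p.2) + F p + r with hf
  have hfm : Measurable f :=
    ((measurable_stepVec.const_inner (c := θ)).add hF.measurable).add measurable_const
  have hgm : Measurable fun p : Env d × steps d B => stepProb p.1 0 p.2 * Real.exp (f p) :=
    measurable_stepProb.mul hfm.exp
  -- The normalization passes from the marginal of μ_ξ to P, and from there to the marginal of every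
  -- competitor.
  have hone : ∀ᵐ ω ∂P, ∑' z : steps d B,
      ENNReal.ofReal (stepProb ω 0 z * Real.exp (f (ω, z))) = 1 :=
    (absolutelyContinuous_marginal₁ hM).ae_le (tsum_eq_one_of_eq_semiProd hgm hform)
  let R : Measure (Env d) → Measure (Env d × steps d B) := fun Q =>
    semiProd Q fun p => stepProb p.1 0 p.2
  have hR : ∀ ν ∈ stationaryMeasures B P, IsProbabilityMeasure (R (marginal₁ ν)) := fun ν hν =>
    isProbabilityMeasure_semiProd_stepProb hB hν.2.1
  have hexp : ∀ ν ∈ stationaryMeasures B P,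
      ∫⁻ p, ENNReal.ofReal (Real.exp (f p)) ∂(R (marginal₁ ν)) = 1 := by
    intro ν hν
    rw [lintegral_semiProd _ measurable_stepProb hfm.exp.ennreal_ofReal]
    simp only [← ENNReal.ofReal_mul (stepProb_nonneg _ _ _)]
    rw [lintegral_congr_ae (hν.2.1.ae_le hone)]
    simp
  have hint : ∀ ν ∈ stationaryMeasures B P,
      Integrable (fun p => Real.exp (f p)) (R (marginal₁ ν)) := fun ν hν =>
    ⟨hfm.exp.aestronglyMeasurable, by
      rw [hasFiniteIntegral_iff_ofReal (Eventually.of_forall fun _ => (Real.exp_pos _).le),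
        hexp ν hν]
      exact ENNReal.one_lt_top⟩
  have hexp' : ∀ ν ∈ stationaryMeasures B P, ∫ p, Real.exp (f p) ∂(R (marginal₁ ν)) = 1 := by
    intro ν hν
    rw [integral_eq_lintegral_of_nonneg_ae (Eventually.of_forall fun _ => (Real.exp_pos _).le)
      hfm.exp.aestronglyMeasurable, hexp ν hν, ENNReal.toReal_one]
  have htilt : ∀ ν ∈ stationaryMeasures B P, (R (marginal₁ ν)).tilted f =
      semiProd (marginal₁ ν) fun p => stepProb p.1 0 p.2 * Real.exp (f p) := by
    intro ν hν
    rw [Measure.tilted, hexp' ν hν, semiProd_mul_exp _ hfm]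
    simp only [div_one]
    rfl
  have hξ : ∀ ν ∈ velocitySet B ξ, meanVelocity ν = ξ := fun ν hν => hν
  have hrate : ∀ ν ∈ stationaryMeasures B P,
      pairRate P ν = InformationTheory.klDiv (ν : Measure _) (R (marginal₁ ν)) := fun ν hν =>
    if_pos hν
  set c : ℝ := inner ℝ θ ξ + r with hc
  have hμR : (μξ : Measure (Env d × steps d B)) = (R (marginal₁ μξ)).tilted f := by
    rw [htilt μξ hM]
    exact hform
  -- For the tilted measure it is the negative part of f that is integrable for free, so the mean is
  -- computed for -f, with -θ, -F and -r.
  have hμ : 0 ≤ c ∧ pairRate P μξ = ENNReal.ofReal c := by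
    have := hR μξ hM
    have e : ∀ p, inner ℝ (-θ) (stepVec p.2) + (-F) p + -r = -f p := by
      intro p
      simp only [hf, Pi.neg_apply, inner_neg_left]
      ring
    have h1 := integrable_neg_part_tilted hfm (hint μξ hM)
    rw [← hμR] at h1
    have h2 := hF.neg.integrable_and_integral_eq hd hM (-θ) (-r) (by simpa only [e] using h1)
    simp only [e] at h2
    rw [integral_neg, hξ _ hA, inner_neg_left, ← neg_add, neg_inj] at h2
    have h3 := klDiv_tilted_self (hint μξ hM) (hexp' μξ hM) (by
      rw [← hμR]
      simpa using h2.1.neg)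
    rw [← hμR, h2.2] at h3
    exact ⟨h3.1, (hrate μξ hM).trans h3.2⟩
  have hdata : ∀ ν ∈ velocitySet B ξ, pairRate P ν ≠ ∞ → ν ∈ stationaryMeasures B P ∧
      (ν : Measure (Env d × steps d B)) ≪ R (marginal₁ ν) ∧
      Integrable (llr (ν : Measure (Env d × steps d B)) (R (marginal₁ ν))) (ν : Measure _) ∧
      Integrable f (ν : Measure _) ∧ ∫ p, f p ∂(ν : Measure (Env d × steps d B)) = c := by
    intro ν hνA hfin
    have hν : ν ∈ stationaryMeasures B P := by
      by_contra h
      exact hfin (if_neg h)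
    have := hR ν hν
    rw [hrate ν hν] at hfin
    obtain ⟨h1, h2⟩ := InformationTheory.klDiv_ne_top_iff.1 hfin
    have h3 := hF.integrable_and_integral_eq hd hν θ r
      (integrable_pos_part_of_integrable_llr hfm (hint ν hν) (hexp' ν hν) h1 h2)
    rw [hξ ν hνA] at h3
    exact ⟨hν, h1, h2, h3⟩
  have hle : ∀ ν ∈ velocitySet B ξ, ENNReal.ofReal c ≤ pairRate P ν := by
    intro ν hνA
    by_cases hfin : pairRate P ν = ∞
    · rw [hfin]
      exact le_top
    obtain ⟨hν, h1, h2, h3, h4⟩ := hdata ν hνA hfin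
    have := hR ν hν
    rw [hrate ν hν, ← h4]
    exact ofReal_integral_le_klDiv_of_tilted (hint ν hν) (hexp' ν hν) h1 h2 h3
  have hval : velocityRate B P ξ = ENNReal.ofReal c :=
    le_antisymm ((iInf₂_le μξ hA).trans hμ.2.le) (le_iInf₂ hle)
  refine ⟨hμ.2.trans hval.symm, fun ν hνA hνr => ?_⟩
  rw [hval] at hνr
  obtain ⟨hν, h1, h2, h3, h4⟩ := hdata ν hνA (hνr ▸ ENNReal.ofReal_ne_top)
  have := hR ν hν
  -- A minimizer equals its own tilted reference measure, which means that it has the kernel of μ_ξ.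
  refine eq_of_eq_semiProd hgm hM hν hform ?_
  rw [← htilt ν hν]
  refine eq_tilted_of_klDiv_eq (hint ν hν) (hexp' ν hν) h1 h2 h3 (h4 ▸ hμ.1) ?_
  rw [← hrate ν hν, hνr, h4]

end RWRE

end

theorem lemma1p6 {d : ℕ} (hd : 1 ≤ d) (B : ℕ)
    (P : Measure (RWRE.Env d)) [IsProbabilityMeasure P]
    [ErgodicVAdd (Fin d → ℤ) (RWRE.Env d) P]
    (hB : ∀ z : Fin d → ℤ, z ∉ RWRE.steps d B → ∀ᵐ ω ∂P, RWRE.stepProb ω 0 z = 0)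
    (ξ : EuclideanSpace ℝ (Fin d))
    (μξ : ProbabilityMeasure (RWRE.Env d × RWRE.steps d B))
    (hA : μξ ∈ RWRE.velocitySet B ξ)
    (hM : μξ ∈ RWRE.stationaryMeasures B P)
    (θ : EuclideanSpace ℝ (Fin d)) (F : RWRE.Env d × RWRE.steps d B → ℝ)
    (hF : RWRE.ClassK P F) (r : ℝ)
    (hform : (μξ : Measure (RWRE.Env d × RWRE.steps d B)) =
      RWRE.semiProd (RWRE.marginal₁ μξ) fun p =>
        RWRE.stepProb p.1 0 p.2 * Real.exp (inner ℝ θ (RWRE.stepVec p.2) + F p + r)) :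
    RWRE.pairRate P μξ = RWRE.velocityRate B P ξ ∧
      ∀ ν ∈ RWRE.velocitySet B ξ,
        RWRE.pairRate P ν = RWRE.velocityRate B P ξ → ν = μξ :=
  RWRE.pairRate_eq_velocityRate_and_unique hd hB hA hM hF hform
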